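/- Let $\mathbb F$ be a finite field, $\mathbb K$ a field and $t\in\mathbb K$. **Conventions.** Let $\mathcal A$ be a (finitely complete, balanced) regular category: it has finite limits and images, every morphism that is both mono and epi is invertible, and epimorphisms are stable under pullback. A *degree function* on $\mathcal A$ with values in $\mathbb K$ assigns to each epimorphism $e$ an element $\delta(e)\in\mathbb K$, such that $\delta(\mathrm{id})=1$, $\delta(e'e)=\delta(e')\delta(e)$ and $\delta(e')=\delta(e)$ whenever $e'$ is a pullback of $e$. The $\mathbb K$-linear category $\mathcal T^0(\mathcal A,\delta)$ has objects $[x]$, $x\in\mathcal A$; $\operatorname{Hom}([x],[y])$ is the $\mathbb K$-vector space with basis $\langle r\rangle$, $r$ running over the subobjects of $x\times y$; for $r\subset x\times y$ and $s\subset y\times z$ the composite of $\langle r\rangle$ followed by $\langle s\rangle$ is $\delta(e)\langle r\star s\rangle$, where $e: r\times_y s\to r\star s$ is the epimorphism onto the image of $r\times_y s\to x\times z$. It is symmetric monoidal with $[x]\otimes[y]=[x\times y]$, $\langle r\rangle\otimes\langle s\rangle=\langle r\times s\rangle$ and unit $[\mathbf 1]$, $\mathbf 1$ being the terminal object. A morphism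 $f:x\to y$ of $\mathcal A$ gives $\Gamma(f):=\langle\text{graph of }f\rangle:[x]\to[y]$. Let $\mathcal T(\mathcal A,\delta)$ be the additive Karoubi envelope of $\mathcal T^0(\mathcal A,\delta)$, with the induced $\mathbb K$-linear symmetric monoidal structure. A functor $\Phi:\mathcal A\to\mathcal A'$ *preserves the degree functions* $\delta,\delta'$ if it preserves epimorphisms and $\delta'(\Phi(e))=\delta(e)$ for every epimorphism $e$. On $\mathbf{Sets}^{op}$, the opposite of the category of finite sets, let $\delta_t(e)=t^{|Y\setminus e(X)|}$ for an epimorphism of $\mathbf{Sets}^{op}$ given by an injective map of sets $e:X\to Y$. On $\mathrm{Vect}_{\mathbb F}$, the category of finite-dimensional $\mathbb F$-vector spaces, let $\delta'_t(e)=t^{\dim\ker e}$. These are degree functions; put $\underline{\operatorname{Rep}}(S_t)=\mathcal T(\mathbf{Sets}^{op},\delta_t)$ and $\underline{\operatorname{Rep}}(GL_t(\mathbb F))=\mathcal T(\mathrm{Vect}_{\mathbb F},\delta'_t)$. **Lemma.** Let $\mathbb F[-]:\mathbf{Sets}^{op}\to\mathrm{Vect}_{\mathbb F}$ be the functor sending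 a finite set $X$ to the space of $\mathbb F$-valued functions on $X$, and a map of sets to the pull-back of functions along it. 1. $\mathbb F[-]$ preserves the degree functions $\delta_t,\delta'_t$, the terminal objects and the pullbacks. 2. The assignment $[X]\mapsto[\mathbb F[X]]$, $\langle r\rangle\mapsto\langle\mathbb F[r]\rangle$ (where $\mathbb F[r]\subset\mathbb F[X\times Y]$ is viewed as a subobject of $\mathbb F[X]\times\mathbb F[Y]$ through the canonical monomorphism $\mathbb F[X\times Y]\to\mathbb F[X]\times\mathbb F[Y]$, products being taken in $\mathbf{Sets}^{op}$ and $\mathrm{Vect}_{\mathbb F}$), extended $\mathbb K$-linearly to morphisms, is a $\mathbb K$-linear functor $\mathcal T^0(\mathbf{Sets}^{op},\delta_t)\to\mathcal T^0(\mathrm{Vect}_{\mathbb F},\delta'_t)$. It is (strong) symmetric monoidal, with structure isomorphisms $[\mathbb F[\mathbf 1]]\to[\mathbf 1]$ and $[\mathbb F[X\times Y]]\to[\mathbb F[X]\times\mathbb F[Y]]$ given by $\Gamma$ of the canonical morphisms of $\mathrm{Vect}_{\mathbb F}$. 3. This functor extends to a $\mathbb K$-linear symmetric monoidal functor $\underline{\operatorname{Rep}}(S_t)\to\underline{\operatorname{Rep}}(GL_t(\mathbb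 F))$: there is such a functor together with a monoidal natural isomorphism between its restriction to $\mathcal T^0(\mathbf{Sets}^{op},\delta_t)$ and the functor of part 2 followed by the inclusion of $\mathcal T^0(\mathrm{Vect}_{\mathbb F},\delta'_t)$ in $\underline{\operatorname{Rep}}(GL_t(\mathbb F))$. -/

import Mathlib

open CategoryTheory CategoryTheory.Limits MonoidalCategory Idempotents

universe w v u v₁ u₁ v₂ u₂

noncomputable section

namespace Knop

/-- A regular category which is finitely complete and balanced: it has a terminal object, all
pullbacks, images, and epimorphisms are stable under pullback. Since it is balanced and has
equalizers, the image of `f` is an epi-mono factorisation of `f`. -/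
class FCRegular (A : Type u) [Category.{v} A] : Prop extends
    HasFiniteLimits A, HasImages A, Balanced A where
  epi_of_isPullback : ∀ {p x y z : A} {e' : p ⟶ x} {f' : p ⟶ y} {f : x ⟶ z} {e : y ⟶ z},
    IsPullback e' f' f e → Epi e → Epi e'

/-- A `K`-valued degree function: a multiplicative function on epimorphisms, equal to `1` on
identities and invariant under pullback. -/
structure DegreeFunction (A : Type u) [Category.{v} A] (K : Type w) [Field K] where
  deg : ∀ {x y : A} (e : x ⟶ y), Epi e → K
  deg_id : ∀ x : A, deg (𝟙 x) inferInstance = 1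
  deg_comp : ∀ {x y z : A} (e : x ⟶ y) (e' : y ⟶ z) (h : Epi e) (h' : Epi e'),
    deg (e ≫ e') (epi_comp e e') = deg e' h' * deg e h
  deg_pullback : ∀ {p x y z : A} {e' : p ⟶ x} {f' : p ⟶ y} {f : x ⟶ z} {e : y ⟶ z},
    IsPullback e' f' f e → ∀ (h : Epi e) (h' : Epi e'), deg e' h' = deg e h

section Span

variable {A : Type u} [Category.{v} A] {K : Type w} [Field K]
variable (δ : DegreeFunction A K)

lemma DegreeFunction.deg_iso {x y : A} (e : x ⟶ y) [IsIso e] (h : Epi e) : δ.deg e h = 1 := by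
  rw [← δ.deg_id y]
  exact δ.deg_pullback (e' := e) (f' := e) (f := 𝟙 y) (e := 𝟙 y)
    (IsPullback.of_vert_isIso ⟨by simp⟩) inferInstance h

lemma DegreeFunction.deg_congr {x y : A} {e e' : x ⟶ y} (he : e = e') (h : Epi e) (h' : Epi e') :
    δ.deg e h = δ.deg e' h' := by
  subst he; rfl

variable [FCRegular A]

/-- The morphism `δ(e) ⟨im⟩` attached to `(a, b) : w ⟶ x × y`, where `e : w ⟶ im` is the
epimorphism onto the image. -/
def span {w x y : A} (a : w ⟶ x) (b : w ⟶ y) : Subobject (x ⨯ y) →₀ K :=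
  Finsupp.single (imageSubobject (prod.lift a b))
    (δ.deg (factorThruImageSubobject (prod.lift a b)) inferInstance)

/-- The basis element `⟨r⟩` given by a relation `r ⊂ x × y`. -/
def rel {x y : A} (r : Subobject (x ⨯ y)) : Subobject (x ⨯ y) →₀ K := Finsupp.single r 1

/-- The first projection of a relation. -/
def relFst {x y : A} (r : Subobject (x ⨯ y)) : (r : A) ⟶ x := r.arrow ≫ prod.fst
/-- The second projection of a relation. -/
def relSnd {x y : A} (r : Subobject (x ⨯ y)) : (r : A) ⟶ y := r.arrow ≫ prod.snd

lemma span_eq {w r x y : A} (a : w ⟶ x) (b : w ⟶ y) (e : w ⟶ r) (m : r ⟶ x ⨯ y)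
    (he : Epi e) [Mono m] (h : e ≫ m = prod.lift a b) :
    span δ a b = Finsupp.single (Subobject.mk m) (δ.deg e he) := by
  let F : MonoFactorisation (prod.lift a b) := { I := r, m := m, e := e, fac := h }
  let k : image (prod.lift a b) ⟶ r := image.lift F
  have hk : k ≫ m = image.ι _ := image.lift_fac F
  have hk' : factorThruImage (prod.lift a b) ≫ k = e := by
    rw [← cancel_mono m, Category.assoc, hk, image.fac, h]
  have : Mono k := mono_of_mono_fac hk
  have : Epi k := epi_of_epi_fac hk'
  have : IsIso k := isIso_of_mono_of_epi k
  have h1 : imageSubobject (prod.lift a b) = Subobject.mk m :=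
    Subobject.mk_eq_mk_of_comm _ _ (asIso k) hk
  have h2 : factorThruImageSubobject (prod.lift a b) ≫
      ((imageSubobjectIso (prod.lift a b)).hom ≫ k) = e := by
    rw [← hk', ← Category.assoc]; congr 1
    rw [← cancel_mono (image.ι _)]
    simp
  have h3 : δ.deg (factorThruImageSubobject (prod.lift a b)) inferInstance = δ.deg e he := by
    rw [← δ.deg_congr h2 (epi_comp _ _) he, δ.deg_comp _ _ inferInstance inferInstance,
      δ.deg_iso ((imageSubobjectIso (prod.lift a b)).hom ≫ k) inferInstance, one_mul]
  unfold span
  rw [h3, h1]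

lemma span_rel {x y : A} (r : Subobject (x ⨯ y)) : span δ (relFst r) (relSnd r) = rel r := by
  rw [span_eq δ (relFst r) (relSnd r) (𝟙 _) r.arrow inferInstance
    (by rw [Category.id_comp]; apply prod.hom_ext
        · rw [prod.lift_fst]; rfl
        · rw [prod.lift_snd]; rfl), δ.deg_id, Subobject.mk_arrow, rel]

lemma span_epi {w' w x y : A} (a : w ⟶ x) (b : w ⟶ y) (e : w' ⟶ w) (he : Epi e) :
    span δ (e ≫ a) (e ≫ b) = δ.deg e he • span δ a b := by
  rw [span_eq δ (e ≫ a) (e ≫ b) (e ≫ factorThruImage (prod.lift a b)) (image.ι (prod.lift a b))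
    (epi_comp _ _) (by rw [Category.assoc, image.fac]; simp [prod.comp_lift]),
    span_eq δ a b (factorThruImage (prod.lift a b)) (image.ι (prod.lift a b)) inferInstance
    (image.fac _), δ.deg_comp _ _ he inferInstance, Finsupp.smul_single, smul_eq_mul, mul_comm]

lemma span_iso {w' w x y : A} (a : w ⟶ x) (b : w ⟶ y) (a' : w' ⟶ x) (b' : w' ⟶ y)
    (e : w' ⟶ w) [IsIso e] (ha : e ≫ a = a') (hb : e ≫ b = b') :
    span δ a' b' = span δ a b := by
  subst ha hb
  rw [span_epi δ a b e inferInstance, δ.deg_iso, one_smul]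

/-- Every span is a multiple of its image relation -/
lemma span_fac {w x y : A} (a : w ⟶ x) (b : w ⟶ y) :
    ∃ (r : Subobject (x ⨯ y)) (e : w ⟶ (r : A)) (_ : Epi e), e ≫ relFst r = a ∧
      e ≫ relSnd r = b :=
  ⟨imageSubobject (prod.lift a b), factorThruImageSubobject (prod.lift a b), inferInstance,
    by rw [relFst, imageSubobject_arrow_comp_assoc, prod.lift_fst],
    by rw [relSnd, imageSubobject_arrow_comp_assoc, prod.lift_snd]⟩

/-- The composite of `⟨r⟩` and `⟨s⟩`: this is `δ(e) ⟨r ⋆ s⟩`, where `r ⋆ s` is the image of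
`r ×_y s ⟶ x × z` and `e` is the epimorphism from `r ×_y s` onto it. -/
def relComp {x y z : A} (r : Subobject (x ⨯ y)) (s : Subobject (y ⨯ z)) :
    Subobject (x ⨯ z) →₀ K :=
  span δ (pullback.fst (relSnd r) (relFst s) ≫ relFst r)
    (pullback.snd (relSnd r) (relFst s) ≫ relSnd s)

/-- The bilinear extension of the composition of relations. -/
def comp {x y z : A} : (Subobject (x ⨯ y) →₀ K) →ₗ[K] (Subobject (y ⨯ z) →₀ K) →ₗ[K]
    (Subobject (x ⨯ z) →₀ K) :=
  Finsupp.linearCombination K fun r => Finsupp.linearCombination K fun s => relComp δ r s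

lemma comp_rel_rel {x y z : A} (r : Subobject (x ⨯ y)) (s : Subobject (y ⨯ z)) :
    comp δ (rel r) (rel s) = relComp δ r s := by
  simp [comp, rel]

lemma comp_span {w w' p x y z : A} (a : w ⟶ x) (b : w ⟶ y) (c : w' ⟶ y) (d : w' ⟶ z)
    (f : p ⟶ w) (g : p ⟶ w') (h : IsPullback f g b c) :
    comp δ (span δ a b) (span δ c d) = span δ (f ≫ a) (g ≫ d) := by
  obtain ⟨r, e₁, he₁, rfl, rfl⟩ := span_fac a b
  obtain ⟨s, e₂, he₂, rfl, rfl⟩ := span_fac c d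
  let q := pullback.fst (relSnd r) (e₂ ≫ relFst s)
  let q' := pullback.snd (relSnd r) (e₂ ≫ relFst s)
  have hq : IsPullback q q' (relSnd r) (e₂ ≫ relFst s) := IsPullback.of_hasPullback _ _
  have hs : IsPullback _ _ (relSnd r) (relFst s) := IsPullback.of_hasPullback _ _
  -- first step
  let k : p ⟶ pullback (relSnd r) (e₂ ≫ relFst s) := hq.lift (f ≫ e₁) g (by simpa using h.w)
  have hk1 : k ≫ q = f ≫ e₁ := hq.lift_fst _ _ _
  have hk2 : k ≫ q' = g := hq.lift_snd _ _ _
  have hkp : IsPullback k f q e₁ := by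
    have h' : IsPullback (k ≫ q') f (e₂ ≫ relFst s) (e₁ ≫ relSnd r) := by
      rw [hk2]; exact h.flip
    exact IsPullback.of_right h' hk1 hq.flip
  let l : pullback (relSnd r) (e₂ ≫ relFst s) ⟶ pullback (relSnd r) (relFst s) :=
    hs.lift q (q' ≫ e₂) (by simpa using hq.w)
  have hl1 : l ≫ pullback.fst _ _ = q := hs.lift_fst _ _ _
  have hl2 : l ≫ pullback.snd _ _ = q' ≫ e₂ := hs.lift_snd _ _ _
  have hlp : IsPullback l q' (pullback.snd _ _) e₂ := by
    have h' : IsPullback (l ≫ pullback.fst _ _) q' (relSnd r) (e₂ ≫ relFst s) := by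
      rw [hl1]; exact hq
    exact IsPullback.of_right h' hl2 hs
  have hke := FCRegular.epi_of_isPullback hkp he₁
  have hle := FCRegular.epi_of_isPullback hlp he₂
  have e : span δ (f ≫ e₁ ≫ relFst r) (g ≫ e₂ ≫ relSnd s) =
      δ.deg (k ≫ l) (epi_comp _ _) • relComp δ r s := by
    rw [relComp, ← span_epi]
    congr 1
    · simp only [Category.assoc]
      rw [← Category.assoc l, hl1, ← Category.assoc, ← Category.assoc, hk1]
    · simp only [Category.assoc]
      rw [← Category.assoc l, hl2, Category.assoc, ← Category.assoc k, hk2]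
  rw [e, span_epi δ _ _ e₁ he₁, span_epi δ _ _ e₂ he₂, span_rel, span_rel]
  rw [map_smul, map_smul, LinearMap.smul_apply, comp_rel_rel, smul_smul,
    δ.deg_comp _ _ hke hle, δ.deg_pullback hkp he₁ hke, δ.deg_pullback hlp he₂ hle]

lemma span_induction {x y : A} {P : (Subobject (x ⨯ y) →₀ K) → Prop} (f : Subobject (x ⨯ y) →₀ K)
    (h0 : P 0) (hadd : ∀ f g, P f → P g → P (f + g))
    (hs : ∀ (c : K) (w : A) (a : w ⟶ x) (b : w ⟶ y), P (c • span δ a b)) : P f := by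
  induction f using Finsupp.induction_linear with
  | zero => exact h0
  | add f g hf hg => exact hadd f g hf hg
  | single r c =>
    have := hs c _ (relFst r) (relSnd r)
    rw [span_rel, rel, Finsupp.smul_single, smul_eq_mul, mul_one] at this
    exact this

lemma comp_assoc {x y z t : A} (f : Subobject (x ⨯ y) →₀ K) (g : Subobject (y ⨯ z) →₀ K)
    (h : Subobject (z ⨯ t) →₀ K) : comp δ (comp δ f g) h = comp δ f (comp δ g h) := by
  induction f using span_induction δ with
  | h0 => simp
  | hadd f f' hf hf' => simp only [map_add, LinearMap.add_apply, hf, hf']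
  | hs k w a b =>
  induction g using span_induction δ with
  | h0 => simp
  | hadd f f' hf hf' => simp only [map_add, LinearMap.add_apply, hf, hf']
  | hs k' w' c d =>
  induction h using span_induction δ with
  | h0 => simp
  | hadd f f' hf hf' => simp only [map_add, hf, hf']
  | hs k'' w'' e f =>
  simp only [map_smul, LinearMap.smul_apply]
  congr 3
  have h1 : IsPullback _ _ b c := IsPullback.of_hasPullback _ _
  have h2 : IsPullback _ _ d e := IsPullback.of_hasPullback _ _
  have h3 : IsPullback _ _ (pullback.snd b c) (pullback.fst d e) := IsPullback.of_hasPullback _ _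
  rw [comp_span δ _ _ _ _ _ _ h1, comp_span δ _ _ _ _ _ _ h2,
    comp_span δ _ _ _ _ _ _ (h3.paste_vert h2),
    comp_span δ _ _ _ _ _ _ (h3.paste_horiz h1)]
  simp only [Category.assoc]

lemma add_comp' {x y z : A} (f f' : Subobject (x ⨯ y) →₀ K) (g : Subobject (y ⨯ z) →₀ K) :
    comp δ (f + f') g = comp δ f g + comp δ f' g := by
  rw [map_add, LinearMap.add_apply]

lemma smul_comp' {x y z : A} (c : K) (f : Subobject (x ⨯ y) →₀ K) (g : Subobject (y ⨯ z) →₀ K) :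
    comp δ (c • f) g = c • comp δ f g := by
  rw [map_smul, LinearMap.smul_apply]

lemma id_comp' {x y : A} (f : Subobject (x ⨯ y) →₀ K) :
    comp δ (span δ (𝟙 x) (𝟙 x)) f = f := by
  induction f using span_induction δ with
  | h0 => simp
  | hadd f f' hf hf' => simp only [map_add, hf, hf']
  | hs k w a b =>
    rw [map_smul, comp_span δ (𝟙 x) (𝟙 x) a b a (𝟙 w) (IsPullback.of_vert_isIso ⟨by simp⟩)]
    simp

lemma comp_id' {x y : A} (f : Subobject (x ⨯ y) →₀ K) :
    comp δ f (span δ (𝟙 y) (𝟙 y)) = f := by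
  induction f using span_induction δ with
  | h0 => simp
  | hadd f f' hf hf' => simp only [map_add, LinearMap.add_apply, hf, hf']
  | hs k w a b =>
    rw [map_smul, LinearMap.smul_apply,
      comp_span δ a b (𝟙 y) (𝟙 y) (𝟙 w) b (IsPullback.of_horiz_isIso ⟨by simp⟩)]
    simp

lemma mono_tensorArrow {x y x' y' r s : A} (i : r ⟶ x ⨯ y) (j : s ⟶ x' ⨯ y') [Mono i] [Mono j] :
    Mono (prod.lift (prod.map (i ≫ prod.fst) (j ≫ prod.fst))
      (prod.map (i ≫ prod.snd) (j ≫ prod.snd))) := by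
  constructor
  intro w f g h
  have h1 := congr($h ≫ prod.fst ≫ prod.fst)
  have h2 := congr($h ≫ prod.fst ≫ prod.snd)
  have h3 := congr($h ≫ prod.snd ≫ prod.fst)
  have h4 := congr($h ≫ prod.snd ≫ prod.snd)
  simp only [Category.assoc, prod.lift_fst_assoc, prod.lift_snd_assoc, prod.map_fst, prod.map_snd]
    at h1 h2 h3 h4
  apply prod.hom_ext
  · rw [← cancel_mono i]
    apply prod.hom_ext <;> simpa only [Category.assoc]
  · rw [← cancel_mono j]
    apply prod.hom_ext <;> simpa only [Category.assoc]

/-- The relation `r × s ⊂ (x × y) × (x' × y') ≅ (x × x') × (y × y')`. -/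
def relTensor {x y x' y' : A} (r : Subobject (x ⨯ y)) (s : Subobject (x' ⨯ y')) :
    Subobject ((x ⨯ x') ⨯ (y ⨯ y')) :=
  have : Mono (prod.lift (prod.map (relFst r) (relFst s)) (prod.map (relSnd r) (relSnd s))) :=
    mono_tensorArrow r.arrow s.arrow
  Subobject.mk (prod.lift (prod.map (relFst r) (relFst s)) (prod.map (relSnd r) (relSnd s)))

/-- The bilinear extension of the product of relations. -/
def tensor {x y x' y' : A} : (Subobject (x ⨯ y) →₀ K) →ₗ[K] (Subobject (x' ⨯ y') →₀ K) →ₗ[K]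
    (Subobject ((x ⨯ x') ⨯ (y ⨯ y')) →₀ K) :=
  Finsupp.linearCombination K fun r => Finsupp.linearCombination K fun s => rel (relTensor r s)

lemma tensor_rel_rel {x y x' y' : A} (r : Subobject (x ⨯ y)) (s : Subobject (x' ⨯ y')) :
    tensor (K := K) (rel r) (rel s) = rel (relTensor r s) := by
  simp [tensor, rel]

lemma rel_relTensor {x y x' y' : A} (r : Subobject (x ⨯ y)) (s : Subobject (x' ⨯ y')) :
    rel (relTensor r s) =
      span δ (prod.map (relFst r) (relFst s)) (prod.map (relSnd r) (relSnd s)) := by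
  have : Mono (prod.lift (prod.map (relFst r) (relFst s)) (prod.map (relSnd r) (relSnd s))) :=
    mono_tensorArrow r.arrow s.arrow
  rw [span_eq δ _ _ (𝟙 _) (prod.lift (prod.map (relFst r) (relFst s))
    (prod.map (relSnd r) (relSnd s))) inferInstance (Category.id_comp _), δ.deg_id]
  rfl

lemma isPullback_prodMap {p x y z p' x' y' z' : A} {a : p ⟶ x} {b : p ⟶ y} {c : x ⟶ z} {d : y ⟶ z}
    {a' : p' ⟶ x'} {b' : p' ⟶ y'} {c' : x' ⟶ z'} {d' : y' ⟶ z'}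
    (h : IsPullback a b c d) (h' : IsPullback a' b' c' d') :
    IsPullback (prod.map a a') (prod.map b b') (prod.map c c') (prod.map d d') := by
  refine ⟨⟨by rw [prod.map_map, prod.map_map, h.w, h'.w]⟩, ⟨PullbackCone.IsLimit.mk _
    (fun s => prod.lift (h.lift (s.fst ≫ prod.fst) (s.snd ≫ prod.fst) ?_)
      (h'.lift (s.fst ≫ prod.snd) (s.snd ≫ prod.snd) ?_)) ?_ ?_ ?_⟩⟩
  · have := congr($(s.condition) ≫ prod.fst)
    simpa only [Category.assoc, prod.map_fst] using this
  · have := congr($(s.condition) ≫ prod.snd)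
    simpa only [Category.assoc, prod.map_snd] using this
  · intro s
    rw [prod.lift_map]
    apply prod.hom_ext
    · rw [prod.lift_fst, h.lift_fst]
    · rw [prod.lift_snd, h'.lift_fst]
  · intro s
    rw [prod.lift_map]
    apply prod.hom_ext
    · rw [prod.lift_fst, h.lift_snd]
    · rw [prod.lift_snd, h'.lift_snd]
  · intro s m h1 h2
    apply prod.hom_ext
    · rw [prod.lift_fst]
      apply h.hom_ext
      · rw [h.lift_fst, ← h1, Category.assoc, Category.assoc, prod.map_fst]
      · rw [h.lift_snd, ← h2, Category.assoc, Category.assoc, prod.map_fst]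
    · rw [prod.lift_snd]
      apply h'.hom_ext
      · rw [h'.lift_fst, ← h1, Category.assoc, Category.assoc, prod.map_snd]
      · rw [h'.lift_snd, ← h2, Category.assoc, Category.assoc, prod.map_snd]

lemma isPullback_prodMap_id {x y z : A} (e : x ⟶ y) :
    IsPullback (prod.map e (𝟙 z)) prod.fst prod.fst e := by
  refine ⟨⟨by rw [prod.map_fst]⟩, ⟨PullbackCone.IsLimit.mk _
    (fun s => prod.lift s.snd (s.fst ≫ prod.snd)) ?_ ?_ ?_⟩⟩
  · intro s
    rw [prod.lift_map]
    apply prod.hom_ext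
    · rw [prod.lift_fst, s.condition]
    · rw [prod.lift_snd, Category.comp_id]
  · intro s
    rw [prod.lift_fst]
  · intro s m h1 h2
    apply prod.hom_ext
    · rw [prod.lift_fst, h2]
    · rw [prod.lift_snd, ← h1, Category.assoc, prod.map_snd, Category.comp_id]

lemma isPullback_prodMap_id' {x y z : A} (e : x ⟶ y) :
    IsPullback (prod.map (𝟙 z) e) prod.snd prod.snd e := by
  refine ⟨⟨by rw [prod.map_snd]⟩, ⟨PullbackCone.IsLimit.mk _
    (fun s => prod.lift (s.fst ≫ prod.fst) s.snd) ?_ ?_ ?_⟩⟩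
  · intro s
    rw [prod.lift_map]
    apply prod.hom_ext
    · rw [prod.lift_fst, Category.comp_id]
    · rw [prod.lift_snd, s.condition]
  · intro s
    rw [prod.lift_snd]
  · intro s m h1 h2
    apply prod.hom_ext
    · rw [prod.lift_fst, ← h1, Category.assoc, prod.map_fst, Category.comp_id]
    · rw [prod.lift_snd, h2]

lemma tensor_span {w w' x y x' y' : A} (a : w ⟶ x) (b : w ⟶ y) (c : w' ⟶ x') (d : w' ⟶ y') :
    tensor (span δ a b) (span δ c d) = span δ (prod.map a c) (prod.map b d) := by
  obtain ⟨r, e₁, he₁, rfl, rfl⟩ := span_fac a b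
  obtain ⟨s, e₂, he₂, rfl, rfl⟩ := span_fac c d
  have p1 := isPullback_prodMap_id (z := w') e₁
  have p2 := isPullback_prodMap_id' (z := (r : A)) e₂
  have h1 := FCRegular.epi_of_isPullback p1 he₁
  have h2 := FCRegular.epi_of_isPullback p2 he₂
  have e : prod.map e₁ e₂ = prod.map e₁ (𝟙 _) ≫ prod.map (𝟙 _) e₂ := by
    rw [prod.map_map, Category.comp_id, Category.id_comp]
  rw [← prod.map_map, ← prod.map_map, e, span_epi δ _ _ _ (epi_comp _ _), ← rel_relTensor,
    span_epi δ _ _ e₁ he₁, span_epi δ _ _ e₂ he₂, span_rel, span_rel, map_smul, map_smul,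
    LinearMap.smul_apply, tensor_rel_rel, smul_smul, δ.deg_comp _ _ h1 h2,
    δ.deg_pullback p1 he₁ h1, δ.deg_pullback p2 he₂ h2]

lemma tensor_comp {x y z x' y' z' : A} (f : Subobject (x ⨯ y) →₀ K) (f' : Subobject (x' ⨯ y') →₀ K)
    (g : Subobject (y ⨯ z) →₀ K) (g' : Subobject (y' ⨯ z') →₀ K) :
    comp δ (tensor f f') (tensor g g') = tensor (comp δ f g) (comp δ f' g') := by
  induction f using span_induction δ with
  | h0 => simp
  | hadd f f' hf hf' => simp only [map_add, LinearMap.add_apply, hf, hf']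
  | hs k w a b =>
  induction f' using span_induction δ with
  | h0 => simp
  | hadd f f' hf hf' => simp only [map_add, LinearMap.add_apply, hf, hf']
  | hs k' w' a' b' =>
  induction g using span_induction δ with
  | h0 => simp
  | hadd f f' hf hf' => simp only [map_add, LinearMap.add_apply, hf, hf']
  | hs l v c d =>
  induction g' using span_induction δ with
  | h0 => simp
  | hadd f f' hf hf' => simp only [map_add, hf, hf']
  | hs l' v' c' d' =>
  have h1 : IsPullback _ _ b c := IsPullback.of_hasPullback _ _
  have h2 : IsPullback _ _ b' c' := IsPullback.of_hasPullback _ _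
  simp only [map_smul, LinearMap.smul_apply, tensor_span]
  rw [comp_span δ _ _ _ _ _ _ h1, comp_span δ _ _ _ _ _ _ h2, tensor_span,
    comp_span δ _ _ _ _ _ _ (isPullback_prodMap h1 h2), prod.map_map, prod.map_map]
  simp only [smul_smul]
  congr 1
  ring

/-- The graph of `f`, as a relation between `x` and `y`. -/
def graph {x y : A} (f : x ⟶ y) : Subobject (x ⨯ y) := Subobject.mk (prod.lift (𝟙 x) f)

lemma rel_graph {x y : A} (f : x ⟶ y) : rel (graph f) = span δ (𝟙 x) f := by
  rw [span_eq δ _ _ (𝟙 _) (prod.lift (𝟙 x) f) inferInstance (Category.id_comp _), δ.deg_id]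
  rfl

lemma comp_span_graph {w x y z : A} (a : w ⟶ x) (b : w ⟶ y) (f : y ⟶ z) :
    comp δ (span δ a b) (rel (graph f)) = span δ a (b ≫ f) := by
  rw [rel_graph, comp_span δ a b (𝟙 y) f (𝟙 w) b (IsPullback.of_horiz_isIso ⟨by simp⟩)]
  simp

lemma comp_graph_span {w x y z : A} (f : z ≅ x) (a : w ⟶ x) (b : w ⟶ y) :
    comp δ (rel (graph f.hom)) (span δ a b) = span δ (a ≫ f.inv) b := by
  rw [rel_graph, comp_span δ (𝟙 z) f.hom a b (a ≫ f.inv) (𝟙 w)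
    (IsPullback.of_vert_isIso ⟨by simp⟩)]
  simp

end Span

/-- The category with objects `[x]` for `x` in `A`, whose morphisms are the formal `K`-linear
combinations of subobjects of `x × y`. -/
structure T0 {A : Type u} [Category.{v} A] {K : Type w} [Field K] (δ : DegreeFunction A K) where
  of : A

namespace T0

variable {A : Type u} [Category.{v} A] [FCRegular A] {K : Type w} [Field K]
variable (δ : DegreeFunction A K)

instance : Category.{max u v w} (T0 δ) where
  Hom X Y := Subobject (X.of ⨯ Y.of) →₀ K
  id X := rel (graph (𝟙 X.of))
  comp f g := comp δ f g
  id_comp f := by rw [rel_graph δ]; exact id_comp' δ f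
  comp_id f := by rw [rel_graph δ]; exact comp_id' δ f
  assoc f g h := comp_assoc δ f g h

instance homAddCommGroup (X Y : T0 δ) : AddCommGroup (X ⟶ Y) :=
  Finsupp.instAddCommGroup

instance homModule (X Y : T0 δ) : Module K (X ⟶ Y) :=
  Finsupp.module _ _

lemma hom_add_comp {X Y Z : T0 δ} (f f' : X ⟶ Y) (g : Y ⟶ Z) :
    (f + f') ≫ g = f ≫ g + f' ≫ g :=
  add_comp' δ f f' g

lemma hom_comp_add {X Y Z : T0 δ} (f : X ⟶ Y) (g g' : Y ⟶ Z) :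
    f ≫ (g + g') = f ≫ g + f ≫ g' :=
  map_add (comp δ f) g g'

instance : Preadditive (T0 δ) where
  homGroup X Y := homAddCommGroup δ X Y
  add_comp _ _ _ f f' g := hom_add_comp δ f f' g
  comp_add _ _ _ f g g' := hom_comp_add δ f g g'

lemma hom_smul_comp {X Y Z : T0 δ} (c : K) (f : X ⟶ Y) (g : Y ⟶ Z) :
    (c • f) ≫ g = c • (f ≫ g) :=
  smul_comp' δ c f g

lemma hom_comp_smul {X Y Z : T0 δ} (f : X ⟶ Y) (c : K) (g : Y ⟶ Z) :
    f ≫ (c • g) = c • (f ≫ g) :=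
  map_smul (comp δ f) c g

instance : Linear K (T0 δ) where
  homModule X Y := homModule δ X Y
  smul_comp _ _ _ c f g := hom_smul_comp δ c f g
  comp_smul _ _ _ f c g := hom_comp_smul δ f c g

/-- The functor sending `f` to the class of its graph. -/
def Γ : A ⥤ T0 δ where
  obj x := ⟨x⟩
  map f := rel (graph f)
  map_id _ := rfl
  map_comp {x y z} f g := by
    change _ = comp δ (rel (graph f)) (rel (graph g))
    rw [rel_graph δ f, comp_span_graph, rel_graph δ]

@[simp] lemma Γ_obj (x : A) : ((Γ δ).obj x).of = x := rfl

/-- The tensor product of objects: `[x] ⊗ [y] = [x × y]`. -/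
def tensorObj (X Y : T0 δ) : T0 δ := ⟨X.of ⨯ Y.of⟩
/-- The tensor product of morphisms. -/
def tensorHom {X Y X' Y' : T0 δ} (f : X ⟶ Y) (g : X' ⟶ Y') :
   tensorObj δ X X' ⟶ tensorObj δ Y Y' := tensor f g

lemma tensorHom_Γ {x y x' y' : A} (f : x ⟶ y) (g : x' ⟶ y') :
    tensorHom δ ((Γ δ).map f) ((Γ δ).map g) = (Γ δ).map (prod.map f g) := by
  change tensor (rel (graph f)) (rel (graph g)) = rel (graph (prod.map f g))
  rw [rel_graph δ f, rel_graph δ g, rel_graph δ (prod.map f g), tensor_span, prod.map_id_id]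

instance : MonoidalCategoryStruct (T0 δ) where
  tensorObj := tensorObj δ
  tensorHom f g := tensorHom δ f g
  whiskerLeft X _ _ f := tensorHom δ (𝟙 X) f
  whiskerRight f X := tensorHom δ f (𝟙 X)
  tensorUnit := ⟨⊤_ A⟩
  associator X Y Z := (Γ δ).mapIso (prod.associator X.of Y.of Z.of)
  leftUnitor X := (Γ δ).mapIso (prod.leftUnitor X.of)
  rightUnitor X := (Γ δ).mapIso (prod.rightUnitor X.of)

lemma id_eq (X : T0 δ) : 𝟙 X = (Γ δ).map (𝟙 X.of) := rfl

lemma associator_nat {x₁ x₂ x₃ y₁ y₂ y₃ : A} (f : Subobject (x₁ ⨯ y₁) →₀ K)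
    (g : Subobject (x₂ ⨯ y₂) →₀ K) (h : Subobject (x₃ ⨯ y₃) →₀ K) :
    comp δ (tensor (tensor f g) h) (rel (graph (prod.associator y₁ y₂ y₃).hom)) =
      comp δ (rel (graph (prod.associator x₁ x₂ x₃).hom)) (tensor f (tensor g h)) := by
  induction f using span_induction δ with
  | h0 => simp
  | hadd f f' hf hf' => simp only [map_add, LinearMap.add_apply, hf, hf']
  | hs k w a b =>
  induction g using span_induction δ with
  | h0 => simp
  | hadd f f' hf hf' => simp only [map_add, LinearMap.add_apply, hf, hf']
  | hs k' w' c d =>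
  induction h using span_induction δ with
  | h0 => simp
  | hadd f f' hf hf' => simp only [map_add, LinearMap.add_apply, hf, hf']
  | hs k'' w'' e f =>
  simp only [map_smul, LinearMap.smul_apply, tensor_span, comp_span_graph, comp_graph_span]
  congr 3
  refine span_iso δ _ _ _ _ (prod.associator w w' w'').hom ?_ ?_
  · rw [← Category.assoc, ← prod.associator_naturality, Category.assoc, Iso.hom_inv_id,
      Category.comp_id]
  · exact (prod.associator_naturality _ _ _).symm

lemma leftUnitor_nat {x y : A} (f : Subobject (x ⨯ y) →₀ K) :
    comp δ (tensor (rel (graph (𝟙 (⊤_ A)))) f) (rel (graph (prod.leftUnitor y).hom)) =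
      comp δ (rel (graph (prod.leftUnitor x).hom)) f := by
  induction f using span_induction δ with
  | h0 => simp
  | hadd f f' hf hf' => simp only [map_add, LinearMap.add_apply, hf, hf']
  | hs k w a b =>
  simp only [map_smul, LinearMap.smul_apply, rel_graph δ (𝟙 (⊤_ A)), tensor_span, comp_span_graph,
    comp_graph_span]
  congr 1
  refine span_iso δ _ _ _ _ (prod.leftUnitor w).hom ?_ ?_
  · rw [← Category.assoc, Iso.comp_inv_eq, prod.leftUnitor_hom_naturality]
  · exact (prod.leftUnitor_hom_naturality _).symm

lemma rightUnitor_nat {x y : A} (f : Subobject (x ⨯ y) →₀ K) :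
    comp δ (tensor f (rel (graph (𝟙 (⊤_ A))))) (rel (graph (prod.rightUnitor y).hom)) =
      comp δ (rel (graph (prod.rightUnitor x).hom)) f := by
  induction f using span_induction δ with
  | h0 => simp
  | hadd f f' hf hf' => simp only [map_add, LinearMap.add_apply, hf, hf']
  | hs k w a b =>
  simp only [map_smul, LinearMap.smul_apply, rel_graph δ (𝟙 (⊤_ A)), tensor_span, comp_span_graph,
    comp_graph_span]
  congr 1
  refine span_iso δ _ _ _ _ (prod.rightUnitor w).hom ?_ ?_
  · rw [← Category.assoc, Iso.comp_inv_eq, prod.rightUnitor_hom_naturality]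
  · exact (prod.rightUnitor_hom_naturality _).symm

lemma braiding_nat {x y x' y' : A} (f : Subobject (x ⨯ y) →₀ K) (g : Subobject (x' ⨯ y') →₀ K) :
    comp δ (tensor f g) (rel (graph (prod.braiding y y').hom)) =
      comp δ (rel (graph (prod.braiding x x').hom)) (tensor g f) := by
  induction f using span_induction δ with
  | h0 => simp
  | hadd f f' hf hf' => simp only [map_add, LinearMap.add_apply, hf, hf']
  | hs k w a b =>
  induction g using span_induction δ with
  | h0 => simp
  | hadd f f' hf hf' => simp only [map_add, LinearMap.add_apply, hf, hf']
  | hs k' w' c d =>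
  simp only [map_smul, LinearMap.smul_apply, tensor_span, comp_span_graph, comp_graph_span]
  rw [smul_comm]
  congr 2
  refine span_iso δ _ _ _ _ (prod.braiding w w').hom ?_ ?_
  · rw [← Category.assoc, Iso.comp_inv_eq]
    exact (braid_natural _ _).symm
  · exact (braid_natural _ _).symm

instance : MonoidalCategory (T0 δ) := MonoidalCategory.ofTensorHom
  (id_tensorHom_id := fun X Y => by
    refine (tensorHom_Γ δ (𝟙 X.of) (𝟙 Y.of)).trans ?_
    rw [prod.map_id_id]; rfl)
  (id_tensorHom := fun _ _ _ _ => rfl)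
  (tensorHom_id := fun _ _ => rfl)
  (tensorHom_comp_tensorHom := fun f₁ f₂ g₁ g₂ => tensor_comp δ f₁ f₂ g₁ g₂)
  (associator_naturality := fun f₁ f₂ f₃ => associator_nat δ f₁ f₂ f₃)
  (leftUnitor_naturality := fun f => leftUnitor_nat δ f)
  (rightUnitor_naturality := fun f => rightUnitor_nat δ f)
  (pentagon := fun W X Y Z => by
    have := congr((Γ δ).map $(prod.pentagon W.of X.of Y.of Z.of))
    simp only [Functor.map_comp, ← tensorHom_Γ] at this
    exact this)
  (triangle := fun X Y => by
    have := congr((Γ δ).map $(prod.triangle X.of Y.of))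
    simp only [Functor.map_comp, ← tensorHom_Γ] at this
    exact this)

open MonoidalCategory

instance : SymmetricCategory (T0 δ) where
  braiding X Y := (Γ δ).mapIso (prod.braiding X.of Y.of)
  braiding_naturality_right X Y Z f := braiding_nat δ _ f
  braiding_naturality_left f Z := braiding_nat δ f _
  hexagon_forward X Y Z := by
    have : (prod.associator X.of Y.of Z.of).hom ≫ (prod.braiding X.of (Y.of ⨯ Z.of)).hom ≫
        (prod.associator Y.of Z.of X.of).hom = prod.map (prod.braiding X.of Y.of).hom (𝟙 _) ≫
        (prod.associator Y.of X.of Z.of).hom ≫ prod.map (𝟙 _) (prod.braiding X.of Z.of).hom := by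
      simp [prod.lift_fst, prod.lift_snd, prod.lift_fst_assoc, prod.lift_snd_assoc]
    have := congr((Γ δ).map $this)
    simp only [Functor.map_comp, ← tensorHom_Γ] at this
    exact this
  hexagon_reverse X Y Z := by
    have : (prod.associator X.of Y.of Z.of).inv ≫ (prod.braiding (X.of ⨯ Y.of) Z.of).hom ≫
        (prod.associator Z.of X.of Y.of).inv = prod.map (𝟙 _) (prod.braiding Y.of Z.of).hom ≫
        (prod.associator X.of Z.of Y.of).inv ≫ prod.map (prod.braiding X.of Z.of).hom (𝟙 _) := by
      simp [prod.lift_fst, prod.lift_snd, prod.lift_fst_assoc, prod.lift_snd_assoc]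
    have := congr((Γ δ).map $this)
    simp only [Functor.map_comp, ← tensorHom_Γ] at this
    exact this
  symmetry X Y := by
    have := congr((Γ δ).map $(prod.symmetry X.of Y.of))
    simp only [Functor.map_comp] at this
    exact this

instance : MonoidalPreadditive (T0 δ) where
  whiskerLeft_zero {X _ _} := map_zero (tensor (K := K) (rel (graph (𝟙 X.of))))
  zero_whiskerRight {X Y Z} :=
    LinearMap.map_zero₂ (tensor (K := K) (x := Y.of) (y := Z.of)) (rel (graph (𝟙 X.of)))
  whiskerLeft_add {X _ _} f g := map_add (tensor (K := K) (rel (graph (𝟙 X.of)))) f g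
  add_whiskerRight {X Y Z} f g :=
    LinearMap.map_add₂ (tensor (K := K) (x := Y.of) (y := Z.of)) f g (rel (graph (𝟙 X.of)))

instance : MonoidalLinear K (T0 δ) where
  whiskerLeft_smul X _ _ r f := map_smul (tensor (K := K) (rel (graph (𝟙 X.of)))) r f
  smul_whiskerRight r Y Z f X :=
    LinearMap.map_smul₂ (tensor (K := K) (x := Y.of) (y := Z.of)) r f (rel (graph (𝟙 X.of)))

end T0

section Kar
variable {C : Type u} [Category.{v} C] [MonoidalCategory C]

instance : MonoidalCategoryStruct (Karoubi C) where
  tensorObj P Q := ⟨P.X ⊗ Q.X, P.p ⊗ₘ Q.p, by simp [tensorHom_comp_tensorHom]⟩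
  tensorHom f g := ⟨f.f ⊗ₘ g.f, by simp [tensorHom_comp_tensorHom]⟩
  whiskerLeft P _ _ f := ⟨P.p ⊗ₘ f.f, by simp [tensorHom_comp_tensorHom]⟩
  whiskerRight f P := ⟨f.f ⊗ₘ P.p, by simp [tensorHom_comp_tensorHom]⟩
  tensorUnit := ⟨𝟙_ C, 𝟙 _, by simp⟩
  associator P Q R :=
    { hom := ⟨((P.p ⊗ₘ Q.p) ⊗ₘ R.p) ≫ (α_ P.X Q.X R.X).hom, by
        simp [tensorHom_comp_tensorHom, tensorHom_comp_tensorHom_assoc]⟩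
      inv := ⟨(P.p ⊗ₘ (Q.p ⊗ₘ R.p)) ≫ (α_ P.X Q.X R.X).inv, by
        simp [tensorHom_comp_tensorHom, tensorHom_comp_tensorHom_assoc]⟩
      hom_inv_id := by
        ext; simp [tensorHom_comp_tensorHom, tensorHom_comp_tensorHom_assoc]
      inv_hom_id := by
        ext; simp [tensorHom_comp_tensorHom, tensorHom_comp_tensorHom_assoc] }
  leftUnitor P :=
    { hom := ⟨(𝟙 _ ⊗ₘ P.p) ≫ (λ_ P.X).hom, by simp⟩
      inv := ⟨P.p ≫ (λ_ P.X).inv, by simp⟩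
      hom_inv_id := by ext; simp
      inv_hom_id := by ext; simp }
  rightUnitor P :=
    { hom := ⟨(P.p ⊗ₘ 𝟙 _) ≫ (ρ_ P.X).hom, by simp⟩
      inv := ⟨P.p ≫ (ρ_ P.X).inv, by simp⟩
      hom_inv_id := by ext; simp
      inv_hom_id := by ext; simp }


@[simp] lemma kar_tensorObj_X (P Q : Karoubi C) : (P ⊗ Q).X = P.X ⊗ Q.X := rfl
@[simp] lemma kar_tensorObj_p (P Q : Karoubi C) : (P ⊗ Q).p = P.p ⊗ₘ Q.p := rfl
@[simp] lemma kar_tensorUnit_X : (𝟙_ (Karoubi C)).X = 𝟙_ C := rfl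
@[simp] lemma kar_tensorUnit_p : (𝟙_ (Karoubi C)).p = 𝟙 (𝟙_ C) := rfl
@[simp] lemma kar_tensorHom_f {P Q P' Q' : Karoubi C} (f : P ⟶ Q) (g : P' ⟶ Q') :
    (f ⊗ₘ g).f = f.f ⊗ₘ g.f := rfl
@[simp] lemma kar_whiskerLeft_f (P : Karoubi C) {Q Q' : Karoubi C} (f : Q ⟶ Q') :
    (P ◁ f).f = P.p ⊗ₘ f.f := rfl
@[simp] lemma kar_whiskerRight_f {Q Q' : Karoubi C} (f : Q ⟶ Q') (P : Karoubi C) :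
    (f ▷ P).f = f.f ⊗ₘ P.p := rfl
@[simp] lemma kar_associator_hom_f (P Q R : Karoubi C) :
    (α_ P Q R).hom.f = ((P.p ⊗ₘ Q.p) ⊗ₘ R.p) ≫ (α_ P.X Q.X R.X).hom := rfl
@[simp] lemma kar_associator_inv_f (P Q R : Karoubi C) :
    (α_ P Q R).inv.f = (P.p ⊗ₘ (Q.p ⊗ₘ R.p)) ≫ (α_ P.X Q.X R.X).inv := rfl
@[simp] lemma kar_leftUnitor_hom_f (P : Karoubi C) :
    (λ_ P).hom.f = (𝟙 _ ⊗ₘ P.p) ≫ (λ_ P.X).hom := rfl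
@[simp] lemma kar_rightUnitor_hom_f (P : Karoubi C) :
    (ρ_ P).hom.f = (P.p ⊗ₘ 𝟙 _) ≫ (ρ_ P.X).hom := rfl

lemma kar_idem_assoc (P : Karoubi C) {Y : C} (f : P.X ⟶ Y) : P.p ≫ P.p ≫ f = P.p ≫ f := by simp

lemma comp_tensor {X Y Z W : C} (f : X ⟶ Y) (g : Y ⟶ Z) (h : W ⟶ W) :
    (f ≫ g) ⊗ₘ h = (f ⊗ₘ h) ≫ (g ▷ W) := by
  rw [← tensorHom_id, tensorHom_comp_tensorHom, Category.comp_id]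

lemma tensor_comp_left {X Y Z W : C} (f : X ⟶ Y) (g : Y ⟶ Z) (h : W ⟶ W) :
    h ⊗ₘ (f ≫ g) = (h ⊗ₘ f) ≫ (W ◁ g) := by
  rw [← id_tensorHom, tensorHom_comp_tensorHom, Category.comp_id]

lemma whiskerRight_comp_tensor {X Y X' Y' W Z : C} (i : X ⟶ Y) (f : Y ⟶ Y') (f' : X ⟶ X')
    (i' : X' ⟶ Y') (h : W ⟶ W) (e : i ≫ f = f' ≫ i') (k : Y' ⊗ W ⟶ Z) :
    i ▷ W ≫ (f ⊗ₘ h) ≫ k = (f' ⊗ₘ h) ≫ i' ▷ W ≫ k := by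
  rw [← tensorHom_id, ← tensorHom_id, tensorHom_comp_tensorHom_assoc,
    tensorHom_comp_tensorHom_assoc, e, Category.comp_id, Category.id_comp]

lemma whiskerLeft_comp_tensor {X Y X' Y' W Z : C} (i : X ⟶ Y) (f : Y ⟶ Y') (f' : X ⟶ X')
    (i' : X' ⟶ Y') (h : W ⟶ W) (e : i ≫ f = f' ≫ i') (k : W ⊗ Y' ⟶ Z) :
    W ◁ i ≫ (h ⊗ₘ f) ≫ k = (h ⊗ₘ f') ≫ W ◁ i' ≫ k := by
  rw [← id_tensorHom, ← id_tensorHom, tensorHom_comp_tensorHom_assoc,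
    tensorHom_comp_tensorHom_assoc, e, Category.comp_id, Category.id_comp]

instance : MonoidalCategory (Karoubi C) := MonoidalCategory.ofTensorHom
  (id_tensorHom_id := fun _ _ => rfl)
  (id_tensorHom := fun _ _ _ _ => rfl)
  (tensorHom_id := fun _ _ => rfl)
  (tensorHom_comp_tensorHom := fun f₁ f₂ g₁ g₂ => by ext; simp [tensorHom_comp_tensorHom])
  (associator_naturality := fun f₁ f₂ f₃ => by
    ext
    simp only [Karoubi.comp_f, kar_tensorHom_f, kar_associator_hom_f, Category.assoc,
      ← associator_naturality, tensorHom_comp_tensorHom_assoc, tensorHom_comp_tensorHom,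
      Karoubi.p_comp, Karoubi.comp_p])
  (leftUnitor_naturality := fun f => by ext; simp)
  (rightUnitor_naturality := fun f => by ext; simp)
  (pentagon := fun W X Y Z => by
    ext
    simp only [Karoubi.comp_f, kar_tensorHom_f, kar_associator_hom_f, Karoubi.id_f,
      kar_tensorObj_p, kar_tensorObj_X, comp_tensor, tensor_comp_left, Category.assoc]
    rw [whiskerRight_comp_tensor _ _ _ _ _ (associator_naturality _ _ _).symm,
      ← associator_naturality_assoc, ← associator_naturality_assoc]
    simp only [tensorHom_comp_tensorHom, tensorHom_comp_tensorHom_assoc, Karoubi.idem]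
    rw [whiskerRight_comp_tensor _ _ _ _ _ (associator_naturality _ _ _).symm]
    simp only [tensorHom_comp_tensorHom, tensorHom_comp_tensorHom_assoc, Karoubi.idem, pentagon])
  (triangle := fun X Y => by
    ext
    simp only [Karoubi.comp_f, kar_tensorHom_f, kar_associator_hom_f, Karoubi.id_f,
      kar_tensorUnit_X, kar_tensorUnit_p, kar_leftUnitor_hom_f, kar_rightUnitor_hom_f,
      comp_tensor, tensor_comp_left, Category.assoc]
    rw [← associator_naturality_assoc]
    simp only [tensorHom_comp_tensorHom, tensorHom_comp_tensorHom_assoc, Karoubi.idem, Category.comp_id, triangle])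

instance [SymmetricCategory C] : SymmetricCategory (Karoubi C) where
  braiding P Q :=
    { hom := ⟨(P.p ⊗ₘ Q.p) ≫ (β_ P.X Q.X).hom, by simp [tensorHom_comp_tensorHom]⟩
      inv := ⟨(Q.p ⊗ₘ P.p) ≫ (β_ P.X Q.X).inv, by simp [tensorHom_comp_tensorHom]⟩
      hom_inv_id := by ext; simp [tensorHom_comp_tensorHom]
      inv_hom_id := by ext; simp [tensorHom_comp_tensorHom] }
  braiding_naturality_right X Y Z f := by ext; simp [tensorHom_comp_tensorHom, tensorHom_comp_tensorHom_assoc]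
  braiding_naturality_left f Z := by ext; simp [tensorHom_comp_tensorHom, tensorHom_comp_tensorHom_assoc]
  hexagon_forward X Y Z := by
    ext
    change (((X.p ⊗ₘ Y.p) ⊗ₘ Z.p) ≫ (α_ _ _ _).hom) ≫ ((X.p ⊗ₘ (Y.p ⊗ₘ Z.p)) ≫ (β_ _ _).hom) ≫
      ((Y.p ⊗ₘ Z.p) ⊗ₘ X.p) ≫ (α_ _ _ _).hom = (((X.p ⊗ₘ Y.p) ≫ (β_ _ _).hom) ⊗ₘ Z.p) ≫
      (((Y.p ⊗ₘ X.p) ⊗ₘ Z.p) ≫ (α_ _ _ _).hom) ≫ (Y.p ⊗ₘ ((X.p ⊗ₘ Z.p) ≫ (β_ _ _).hom))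
    simp only [comp_tensor, tensor_comp_left, Category.assoc]
    rw [← BraidedCategory.braiding_naturality_assoc]
    simp only [tensorHom_comp_tensorHom, tensorHom_comp_tensorHom_assoc, Karoubi.idem]
    rw [← associator_naturality_assoc, ← associator_naturality_assoc,
      whiskerRight_comp_tensor _ _ _ _ _ (BraidedCategory.braiding_naturality _ _).symm]
    simp only [tensorHom_comp_tensorHom, tensorHom_comp_tensorHom_assoc, Karoubi.idem]
    rw [whiskerRight_comp_tensor _ _ _ _ _ (BraidedCategory.braiding_naturality _ _).symm]
    simp only [tensorHom_comp_tensorHom, tensorHom_comp_tensorHom_assoc, Karoubi.idem, BraidedCategory.hexagon_forward]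
  hexagon_reverse X Y Z := by
    ext
    change ((X.p ⊗ₘ (Y.p ⊗ₘ Z.p)) ≫ (α_ _ _ _).inv) ≫ (((X.p ⊗ₘ Y.p) ⊗ₘ Z.p) ≫ (β_ _ _).hom) ≫
      (Z.p ⊗ₘ (X.p ⊗ₘ Y.p)) ≫ (α_ _ _ _).inv = (X.p ⊗ₘ ((Y.p ⊗ₘ Z.p) ≫ (β_ _ _).hom)) ≫
      ((X.p ⊗ₘ (Z.p ⊗ₘ Y.p)) ≫ (α_ _ _ _).inv) ≫ (((X.p ⊗ₘ Z.p) ≫ (β_ _ _).hom) ⊗ₘ Y.p)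
    simp only [comp_tensor, tensor_comp_left, Category.assoc]
    rw [← BraidedCategory.braiding_naturality_assoc]
    simp only [tensorHom_comp_tensorHom, tensorHom_comp_tensorHom_assoc, Karoubi.idem]
    rw [← associator_inv_naturality_assoc, ← associator_inv_naturality_assoc,
      whiskerLeft_comp_tensor _ _ _ _ _ (BraidedCategory.braiding_naturality _ _).symm]
    simp only [tensorHom_comp_tensorHom, tensorHom_comp_tensorHom_assoc, Karoubi.idem]
    rw [whiskerLeft_comp_tensor _ _ _ _ _ (BraidedCategory.braiding_naturality _ _).symm]
    simp only [tensorHom_comp_tensorHom, tensorHom_comp_tensorHom_assoc, Karoubi.idem, BraidedCategory.hexagon_reverse]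
  symmetry X Y := by ext; simp [tensorHom_comp_tensorHom]

@[simp] lemma kar_braiding_hom_f [SymmetricCategory C] (P Q : Karoubi C) :
    (β_ P Q).hom.f = (P.p ⊗ₘ Q.p) ≫ (β_ P.X Q.X).hom := rfl

instance [Preadditive C] [MonoidalPreadditive C] : MonoidalPreadditive (Karoubi C) where
  whiskerLeft_add f g := by ext; exact MonoidalPreadditive.tensor_add _ _ _
  add_whiskerRight f g := by ext; exact MonoidalPreadditive.add_tensor _ _ _

instance toKaroubiMonoidal : (toKaroubi C).Monoidal :=
  Functor.CoreMonoidal.toMonoidal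
    { εIso := Iso.refl _
      μIso X Y :=
        { hom := ⟨𝟙 _, by simp⟩
          inv := ⟨𝟙 _, by simp⟩ } }

instance [SymmetricCategory C] : (toKaroubi C).Braided where
  braided X Y := by
    ext
    change 𝟙 _ ≫ (β_ X Y).hom = ((𝟙 X ⊗ₘ 𝟙 Y) ≫ (β_ X Y).hom) ≫ 𝟙 _
    simp

section Lin
variable (K : Type w) [Field K] [Preadditive C] [Linear K C]

instance (P Q : Karoubi C) : SMul K (P ⟶ Q) where
  smul c f := ⟨c • f.f, by simp⟩

@[simp] lemma kar_smul_f {P Q : Karoubi C} (c : K) (f : P ⟶ Q) : (c • f).f = c • f.f := rfl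

instance (P Q : Karoubi C) : Module K (P ⟶ Q) where
  one_smul f := by ext; simp
  mul_smul a b f := by ext; simp [mul_smul]
  smul_zero a := by ext; simp
  smul_add a f g := by ext; simp
  add_smul a b f := by ext; simp [add_smul]
  zero_smul f := by ext; simp

instance : Linear K (Karoubi C) where

end Lin
end Kar

section Matr
variable {C : Type u} [Category.{v} C] [Preadditive C]

/-- The `(i, j)` entry of a matrix of morphisms. -/
def ent {M N : Mat_ C} (f : M ⟶ N) (i : M.ι) (j : N.ι) : M.X i ⟶ N.X j := f i j

/-- The matrix with given entries. -/
def ofEnt {M N : Mat_ C} (f : ∀ i j, M.X i ⟶ N.X j) : M ⟶ N := fun i j => f i j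

@[simp] lemma ent_ofEnt {M N : Mat_ C} (f : ∀ i j, M.X i ⟶ N.X j) (i : M.ι) (j : N.ι) :
    ent (ofEnt (M := M) (N := N) f) i j = f i j := rfl

lemma mat_ext {M N : Mat_ C} {f g : M ⟶ N} (h : ∀ i j, ent f i j = ent g i j) : f = g :=
  Mat_.hom_ext _ _ h

lemma ent_comp {M N P : Mat_ C} (f : M ⟶ N) (g : N ⟶ P) (i : M.ι) (k : P.ι) :
    ent (f ≫ g) i k = ∑ j, ent f i j ≫ ent g j k := rfl

@[simp] lemma ent_add {M N : Mat_ C} (f g : M ⟶ N) (i : M.ι) (j : N.ι) :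
    ent (f + g) i j = ent f i j + ent g i j := rfl

lemma ent_id_self (M : Mat_ C) (i : M.ι) : ent (𝟙 M) i i = 𝟙 _ := Mat_.id_apply_self M i

lemma ent_id_ne (M : Mat_ C) {i j : M.ι} (h : i ≠ j) : ent (𝟙 M) i j = 0 :=
  Mat_.id_apply_of_ne M i j h

open scoped Classical in
/-- The monomial matrix with entry `φ i` in position `(i, e i)`. -/
def monomial {M N : Mat_ C} (e : M.ι → N.ι) (φ : ∀ i, M.X i ⟶ N.X (e i)) : M ⟶ N :=
  ofEnt fun i j => if h : e i = j then φ i ≫ eqToHom (congrArg N.X h) else 0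

lemma monomial_self {M N : Mat_ C} (e : M.ι → N.ι) (φ : ∀ i, M.X i ⟶ N.X (e i)) (i : M.ι) :
    ent (monomial e φ) i (e i) = φ i := by
  simp [monomial]

lemma monomial_ne {M N : Mat_ C} (e : M.ι → N.ι) (φ : ∀ i, M.X i ⟶ N.X (e i)) {i : M.ι} {j : N.ι}
    (h : e i ≠ j) : ent (monomial e φ) i j = 0 := by
  simp [monomial, h]

lemma eq_monomial {M N : Mat_ C} (f : M ⟶ N) (e : M.ι → N.ι) (φ : ∀ i, M.X i ⟶ N.X (e i))
    (h : ∀ i, ent f i (e i) = φ i) (h' : ∀ i j, e i ≠ j → ent f i j = 0) : f = monomial e φ := by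
  apply mat_ext
  intro i j
  by_cases hij : e i = j
  · subst hij; rw [h, monomial_self]
  · rw [h' i j hij, monomial_ne _ _ hij]

lemma id_eq_monomial (M : Mat_ C) : 𝟙 M = monomial (M := M) (N := M) id (fun i => 𝟙 (M.X i)) :=
  eq_monomial _ _ _ (fun i => ent_id_self M i) (fun _ _ h => ent_id_ne M h)

lemma monomial_comp_ent {M N P : Mat_ C} (e : M.ι → N.ι) (φ : ∀ i, M.X i ⟶ N.X (e i)) (g : N ⟶ P)
    (i : M.ι) (k : P.ι) : ent (monomial e φ ≫ g) i k = φ i ≫ ent g (e i) k := by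
  rw [ent_comp, Finset.sum_eq_single (e i)]
  · rw [monomial_self]
  · intro j _ hj
    rw [monomial_ne _ _ hj.symm, zero_comp]
  · simp

lemma comp_monomial_ent {M N P : Mat_ C} (g : P ⟶ M) (e : M.ι → N.ι) (he : Function.Injective e)
    (φ : ∀ i, M.X i ⟶ N.X (e i)) (k : P.ι) (i : M.ι) :
    ent (g ≫ monomial e φ) k (e i) = ent g k i ≫ φ i := by
  rw [ent_comp, Finset.sum_eq_single i]
  · rw [monomial_self]
  · intro j _ hj
    rw [monomial_ne _ _ (fun h => hj (he h)), comp_zero]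
  · simp

lemma monomial_comp {M N P : Mat_ C} (e : M.ι → N.ι) (φ : ∀ i, M.X i ⟶ N.X (e i))
    (e' : N.ι → P.ι) (φ' : ∀ i, N.X i ⟶ P.X (e' i)) :
    monomial e φ ≫ monomial e' φ' = monomial (fun i => e' (e i)) (fun i => φ i ≫ φ' (e i)) := by
  apply eq_monomial
  · intro i
    rw [monomial_comp_ent, monomial_self]
  · intro i j h
    rw [monomial_comp_ent, monomial_ne _ _ h, comp_zero]

lemma monomial_congr {M N : Mat_ C} {e : M.ι → N.ι} {φ ψ : ∀ i, M.X i ⟶ N.X (e i)}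
    (h : ∀ i, φ i = ψ i) : monomial e φ = monomial e ψ := by
  rw [funext h]

variable [MonoidalCategory C]

/-- The tensor product of two finite families of objects. -/
abbrev matTensor (M N : Mat_ C) : Mat_ C := ⟨M.ι × N.ι, fun p => M.X p.1 ⊗ N.X p.2⟩

/-- The Kronecker product of matrices of morphisms. -/
def matTensorHom {M N M' N' : Mat_ C} (f : M ⟶ N) (g : M' ⟶ N') :
    matTensor M M' ⟶ matTensor N N' :=
  ofEnt (M := matTensor M M') (N := matTensor N N') fun p q => ent f p.1 q.1 ⊗ₘ ent g p.2 q.2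

@[simp] lemma ent_matTensorHom {M N M' N' : Mat_ C} (f : M ⟶ N) (g : M' ⟶ N') (p : M.ι × M'.ι)
    (q : N.ι × N'.ι) : ent (matTensorHom f g) p q = ent f p.1 q.1 ⊗ₘ ent g p.2 q.2 := rfl

/-- The associator. -/
def matAssoc (M N P : Mat_ C) : matTensor (matTensor M N) P ≅ matTensor M (matTensor N P) where
  hom := monomial (M := matTensor (matTensor M N) P) (N := matTensor M (matTensor N P))
    (fun p => (p.1.1, p.1.2, p.2)) (fun p => (α_ (M.X p.1.1) (N.X p.1.2) (P.X p.2)).hom)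
  inv := monomial (M := matTensor M (matTensor N P)) (N := matTensor (matTensor M N) P)
    (fun p => ((p.1, p.2.1), p.2.2)) (fun p => (α_ (M.X p.1) (N.X p.2.1) (P.X p.2.2)).inv)
  hom_inv_id := by
    rw [monomial_comp, id_eq_monomial]
    exact monomial_congr fun i => Iso.hom_inv_id _
  inv_hom_id := by
    rw [monomial_comp, id_eq_monomial]
    exact monomial_congr fun i => Iso.inv_hom_id _

/-- The unit object. -/
abbrev matUnit : Mat_ C := ⟨PUnit, fun _ => 𝟙_ C⟩

/-- The left unitor. -/
def matLeftUnitor (M : Mat_ C) : matTensor matUnit M ≅ M where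
  hom := monomial (M := matTensor matUnit M) (N := M) (fun p => p.2) (fun p => (λ_ (M.X p.2)).hom)
  inv := monomial (M := M) (N := matTensor matUnit M) (fun i => (PUnit.unit, i))
    (fun i => (λ_ (M.X i)).inv)
  hom_inv_id := by
    rw [monomial_comp, id_eq_monomial]
    exact monomial_congr fun i => Iso.hom_inv_id _
  inv_hom_id := by
    rw [monomial_comp, id_eq_monomial]
    exact monomial_congr fun i => Iso.inv_hom_id _

/-- The right unitor. -/
def matRightUnitor (M : Mat_ C) : matTensor M matUnit ≅ M where
  hom := monomial (M := matTensor M matUnit) (N := M) (fun p => p.1) (fun p => (ρ_ (M.X p.1)).hom)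
  inv := monomial (M := M) (N := matTensor M matUnit) (fun i => (i, PUnit.unit))
    (fun i => (ρ_ (M.X i)).inv)
  hom_inv_id := by
    rw [monomial_comp, id_eq_monomial]
    exact monomial_congr fun i => Iso.hom_inv_id _
  inv_hom_id := by
    rw [monomial_comp, id_eq_monomial]
    exact monomial_congr fun i => Iso.inv_hom_id _

variable [MonoidalPreadditive C]

lemma matTensor_monomial {M N M' N' : Mat_ C} (e : M.ι → N.ι) (φ : ∀ i, M.X i ⟶ N.X (e i))
    (e' : M'.ι → N'.ι) (φ' : ∀ i, M'.X i ⟶ N'.X (e' i)) :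
    matTensorHom (monomial e φ) (monomial e' φ') =
      monomial (M := matTensor M M') (N := matTensor N N') (fun p => (e p.1, e' p.2))
        (fun p => φ p.1 ⊗ₘ φ' p.2) := by
  apply eq_monomial
  · intro i
    rw [ent_matTensorHom, monomial_self, monomial_self]
  · rintro ⟨i, i'⟩ ⟨j, j'⟩ h
    rw [ent_matTensorHom]
    by_cases h1 : e i = j
    · have h2 : e' i' ≠ j' := fun h2 => h (by rw [h1, h2])
      rw [monomial_ne e' φ' h2, MonoidalPreadditive.tensor_zero]
    · rw [monomial_ne e φ h1, MonoidalPreadditive.zero_tensor]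

lemma matTensor_comp {M N P M' N' P' : Mat_ C} (f : M ⟶ N) (f' : M' ⟶ N') (g : N ⟶ P)
    (g' : N' ⟶ P') :
    matTensorHom f f' ≫ matTensorHom g g' = matTensorHom (f ≫ g) (f' ≫ g') := by
  apply mat_ext
  rintro ⟨i, i'⟩ ⟨k, k'⟩
  rw [ent_comp, ent_matTensorHom, ent_comp, ent_comp, sum_tensor]
  simp only [tensor_sum]
  refine (Fintype.sum_prod_type _).trans ?_
  simp only [ent_matTensorHom, tensorHom_comp_tensorHom]

lemma matTensor_id (M N : Mat_ C) : matTensorHom (𝟙 M) (𝟙 N) = 𝟙 (matTensor M N) := by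
  rw [id_eq_monomial, id_eq_monomial, id_eq_monomial, matTensor_monomial]
  exact monomial_congr fun i => id_tensorHom_id _ _

instance : MonoidalCategoryStruct (Mat_ C) where
  tensorObj := matTensor
  tensorHom f g := matTensorHom f g
  whiskerLeft M _ _ f := matTensorHom (𝟙 M) f
  whiskerRight f M := matTensorHom f (𝟙 M)
  tensorUnit := matUnit
  associator := matAssoc
  leftUnitor := matLeftUnitor
  rightUnitor := matRightUnitor

instance : MonoidalCategory (Mat_ C) := MonoidalCategory.ofTensorHom
  (id_tensorHom_id := fun M N => matTensor_id M N)
  (id_tensorHom := fun _ _ _ _ => rfl)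
  (tensorHom_id := fun _ _ => rfl)
  (tensorHom_comp_tensorHom := fun f₁ f₂ g₁ g₂ => matTensor_comp f₁ f₂ g₁ g₂)
  (associator_naturality := fun {X₁ X₂ X₃ Y₁ Y₂ Y₃} f₁ f₂ f₃ => by
    apply mat_ext
    rintro ⟨⟨i, j⟩, k⟩ ⟨i', j', k'⟩
    refine (comp_monomial_ent (M := matTensor (matTensor Y₁ Y₂) Y₃)
      (N := matTensor Y₁ (matTensor Y₂ Y₃)) _ (fun p => (p.1.1, p.1.2, p.2)) ?_ _ _
      ((i', j'), k')).trans
      (Eq.trans ?_ (monomial_comp_ent (M := matTensor (matTensor X₁ X₂) X₃)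
      (N := matTensor X₁ (matTensor X₂ X₃)) _ _ _ _ _).symm)
    · rintro ⟨⟨a, b⟩, c⟩ ⟨⟨a', b'⟩, c'⟩ h
      simp only [Prod.mk.injEq] at h ⊢
      tauto
    · exact associator_naturality _ _ _)
  (leftUnitor_naturality := fun {X Y} f => by
    apply mat_ext
    rintro ⟨⟨⟩, i⟩ j
    refine (comp_monomial_ent (M := matTensor matUnit Y) (N := Y) _ (fun p => p.2) ?_ _ _
      (PUnit.unit, j)).trans (Eq.trans ?_ (monomial_comp_ent (M := matTensor matUnit X)
      (N := X) _ _ _ _ _).symm)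
    · rintro ⟨⟨⟩, a⟩ ⟨⟨⟩, b⟩ h
      exact congrArg _ h
    · refine Eq.trans (congrArg (· ≫ _) ?_) (leftUnitor_naturality (ent f i j))
      refine (ent_matTensorHom _ _ _ _).trans ?_
      erw [ent_id_self]
      exact id_tensorHom _ _)
  (rightUnitor_naturality := fun {X Y} f => by
    apply mat_ext
    rintro ⟨i, ⟨⟩⟩ j
    refine (comp_monomial_ent (M := matTensor Y matUnit) (N := Y) _ (fun p => p.1) ?_ _ _
      (j, PUnit.unit)).trans (Eq.trans ?_ (monomial_comp_ent (M := matTensor X matUnit)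
      (N := X) _ _ _ _ _).symm)
    · rintro ⟨a, ⟨⟩⟩ ⟨b, ⟨⟩⟩ h
      exact congrArg (fun x => (x, PUnit.unit)) h
    · refine Eq.trans (congrArg (· ≫ _) ?_) (rightUnitor_naturality (ent f i j))
      refine (ent_matTensorHom _ _ _ _).trans ?_
      erw [ent_id_self]
      exact tensorHom_id _ _)
  (pentagon := fun W X Y Z => by
    change matTensorHom (matAssoc W X Y).hom (𝟙 Z) ≫ (matAssoc W (matTensor X Y) Z).hom ≫
      matTensorHom (𝟙 W) (matAssoc X Y Z).hom = (matAssoc (matTensor W X) Y Z).hom ≫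
      (matAssoc W X (matTensor Y Z)).hom
    simp only [matAssoc, id_eq_monomial, matTensor_monomial]
    rw [monomial_comp, monomial_comp, monomial_comp]
    refine monomial_congr fun i => ?_
    simp only [tensorHom_id, id_tensorHom]
    exact pentagon _ _ _ _)
  (triangle := fun X Y => by
    change (matAssoc X matUnit Y).hom ≫ matTensorHom (𝟙 X) (matLeftUnitor Y).hom =
      matTensorHom (matRightUnitor X).hom (𝟙 Y)
    simp only [matAssoc, matLeftUnitor, matRightUnitor, id_eq_monomial, matTensor_monomial]
    rw [monomial_comp]
    refine monomial_congr fun i => ?_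
    simp only [tensorHom_id, id_tensorHom]
    exact triangle _ _)

instance : MonoidalPreadditive (Mat_ C) where
  whiskerLeft_zero := mat_ext fun _ _ => MonoidalPreadditive.tensor_zero _
  zero_whiskerRight := mat_ext fun _ _ => MonoidalPreadditive.zero_tensor _
  whiskerLeft_add _ _ := mat_ext fun _ _ => MonoidalPreadditive.tensor_add _ _ _
  add_whiskerRight _ _ := mat_ext fun _ _ => MonoidalPreadditive.add_tensor _ _ _

/-- The symmetry. -/
def matBraiding [SymmetricCategory C] (M N : Mat_ C) : matTensor M N ≅ matTensor N M where
  hom := monomial (M := matTensor M N) (N := matTensor N M) (fun p => (p.2, p.1))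
    (fun p => (β_ (M.X p.1) (N.X p.2)).hom)
  inv := monomial (M := matTensor N M) (N := matTensor M N) (fun p => (p.2, p.1))
    (fun p => (β_ (M.X p.2) (N.X p.1)).inv)
  hom_inv_id := by
    rw [monomial_comp, id_eq_monomial]
    exact monomial_congr fun i => Iso.hom_inv_id _
  inv_hom_id := by
    rw [monomial_comp, id_eq_monomial]
    exact monomial_congr fun i => Iso.inv_hom_id _

lemma matBraiding_naturality [SymmetricCategory C] {M N M' N' : Mat_ C} (f : M ⟶ N)
    (g : M' ⟶ N') : matTensorHom f g ≫ (matBraiding N N').hom =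
      (matBraiding M M').hom ≫ matTensorHom g f := by
  apply mat_ext
  rintro ⟨i, i'⟩ ⟨j', j⟩
  refine (comp_monomial_ent (M := matTensor N N') (N := matTensor N' N) _ (fun p => (p.2, p.1))
    (fun a b h => Prod.swap_injective h) _ _ (j, j')).trans
    (Eq.trans ?_ (monomial_comp_ent (M := matTensor M M') (N := matTensor M' M) _ _ _ _ _).symm)
  exact BraidedCategory.braiding_naturality _ _

instance [SymmetricCategory C] : SymmetricCategory (Mat_ C) where
  braiding := matBraiding
  braiding_naturality_right X _ _ f := matBraiding_naturality (𝟙 X) f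
  braiding_naturality_left f Z := matBraiding_naturality f (𝟙 Z)
  hexagon_forward X Y Z := by
    change (matAssoc X Y Z).hom ≫ (matBraiding X (matTensor Y Z)).hom ≫ (matAssoc Y Z X).hom =
      matTensorHom (matBraiding X Y).hom (𝟙 Z) ≫ (matAssoc Y X Z).hom ≫
        matTensorHom (𝟙 Y) (matBraiding X Z).hom
    simp only [matAssoc, matBraiding, id_eq_monomial, matTensor_monomial]
    rw [monomial_comp, monomial_comp, monomial_comp, monomial_comp]
    refine monomial_congr fun i => ?_
    simp only [tensorHom_id, id_tensorHom]
    exact BraidedCategory.hexagon_forward _ _ _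
  hexagon_reverse X Y Z := by
    change (matAssoc X Y Z).inv ≫ (matBraiding (matTensor X Y) Z).hom ≫ (matAssoc Z X Y).inv =
      matTensorHom (𝟙 X) (matBraiding Y Z).hom ≫ (matAssoc X Z Y).inv ≫
        matTensorHom (matBraiding X Z).hom (𝟙 Y)
    simp only [matAssoc, matBraiding, id_eq_monomial, matTensor_monomial]
    rw [monomial_comp, monomial_comp, monomial_comp, monomial_comp]
    refine monomial_congr fun i => ?_
    simp only [tensorHom_id, id_tensorHom]
    exact BraidedCategory.hexagon_reverse _ _ _
  symmetry X Y := by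
    change (matBraiding X Y).hom ≫ (matBraiding Y X).hom = 𝟙 (matTensor X Y)
    simp only [matBraiding]
    rw [monomial_comp, id_eq_monomial]
    exact monomial_congr fun i => SymmetricCategory.symmetry _ _

/-- The one-term family. -/
abbrev single (X : C) : Mat_ C := ⟨PUnit, fun _ => X⟩

/-- The `1 × 1` matrix of a morphism. -/
def embMap {X Y : C} (f : X ⟶ Y) : single X ⟶ single Y := (Mat_.embedding C).map f

lemma embMap_eq {X Y : C} (f : X ⟶ Y) :
    embMap f = monomial (M := single X) (N := single Y) (fun i => i) (fun _ => f) :=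
  eq_monomial _ _ _ (fun _ => rfl) (fun i j h => (h (Subsingleton.elim (α := PUnit) i j)).elim)

/-- Compatibility of one-term families with tensor products. -/
def embMu (X Y : C) : matTensor (single X) (single Y) ≅ single (X ⊗ Y) where
  hom := monomial (M := matTensor (single X) (single Y)) (N := single (X ⊗ Y))
    (fun _ => PUnit.unit) (fun _ => 𝟙 (X ⊗ Y))
  inv := monomial (N := matTensor (single X) (single Y)) (M := single (X ⊗ Y))
    (fun _ => (PUnit.unit, PUnit.unit)) (fun _ => 𝟙 (X ⊗ Y))
  hom_inv_id := by
    rw [monomial_comp, id_eq_monomial]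
    exact monomial_congr fun i => Category.comp_id _
  inv_hom_id := by
    rw [monomial_comp, id_eq_monomial]
    exact monomial_congr fun i => Category.comp_id _

instance embeddingMonoidal : (Mat_.embedding C).Monoidal :=
  Functor.CoreMonoidal.toMonoidal
    { εIso := Iso.refl _
      μIso := embMu
      μIso_hom_natural_left {X Y} f Z := by
        change matTensorHom (embMap f) (𝟙 (single Z)) ≫ (embMu Y Z).hom =
          (embMu X Z).hom ≫ embMap (f ▷ Z)
        simp only [embMu, embMap_eq, id_eq_monomial, matTensor_monomial]
        rw [monomial_comp, monomial_comp]
        exact monomial_congr fun i => by simp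
      μIso_hom_natural_right {X Y} Z f := by
        change matTensorHom (𝟙 (single Z)) (embMap f) ≫ (embMu Z Y).hom =
          (embMu Z X).hom ≫ embMap (Z ◁ f)
        simp only [embMu, embMap_eq, id_eq_monomial, matTensor_monomial]
        rw [monomial_comp, monomial_comp]
        exact monomial_congr fun i => by simp
      associativity X Y Z := by
        change matTensorHom (embMu X Y).hom (𝟙 (single Z)) ≫ (embMu (X ⊗ Y) Z).hom ≫
            embMap (α_ X Y Z).hom =
          (matAssoc (single X) (single Y) (single Z)).hom ≫
            matTensorHom (𝟙 (single X)) (embMu Y Z).hom ≫ (embMu X (Y ⊗ Z)).hom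
        simp only [embMu, matAssoc, embMap_eq, id_eq_monomial, matTensor_monomial]
        rw [monomial_comp, monomial_comp, monomial_comp, monomial_comp]
        exact monomial_congr fun i => by simp
      left_unitality X := by
        change (matLeftUnitor (single X)).hom = matTensorHom (𝟙 (single (𝟙_ C))) (𝟙 (single X)) ≫
          (embMu (𝟙_ C) X).hom ≫ embMap (λ_ X).hom
        simp only [embMu, matLeftUnitor, embMap_eq, id_eq_monomial, matTensor_monomial]
        rw [monomial_comp, monomial_comp]
        exact monomial_congr fun i => by simp
      right_unitality X := by
        change (matRightUnitor (single X)).hom = matTensorHom (𝟙 (single X)) (𝟙 (single (𝟙_ C))) ≫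
          (embMu X (𝟙_ C)).hom ≫ embMap (ρ_ X).hom
        simp only [embMu, matRightUnitor, embMap_eq, id_eq_monomial, matTensor_monomial]
        rw [monomial_comp, monomial_comp]
        exact monomial_congr fun i => by simp }

instance [SymmetricCategory C] : (Mat_.embedding C).Braided where
  braided X Y := by
    change (embMu X Y).hom ≫ embMap (β_ X Y).hom =
      (matBraiding (single X) (single Y)).hom ≫ (embMu Y X).hom
    simp only [embMu, matBraiding, embMap_eq]
    rw [monomial_comp, monomial_comp]
    exact monomial_congr fun i => by simp

section Lin
variable (K : Type w) [Field K] [Linear K C]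

instance matModule (M N : Mat_ C) : Module K (M ⟶ N) :=
  inferInstanceAs (Module K (∀ (i : M.ι) (j : N.ι), M.X i ⟶ N.X j))

@[simp] lemma ent_smul {M N : Mat_ C} (c : K) (f : M ⟶ N) (i : M.ι) (j : N.ι) :
    ent (c • f) i j = c • ent f i j := rfl

instance : Linear K (Mat_ C) where
  smul_comp M N P c f g := mat_ext fun i k => by
    rw [ent_smul, ent_comp, ent_comp, Finset.smul_sum]
    simp
  comp_smul M N P f c g := mat_ext fun i k => by
    rw [ent_smul, ent_comp, ent_comp, Finset.smul_sum]
    simp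

end Lin
end Matr

section T

variable {A : Type u} [Category.{v} A] [FCRegular A] {K : Type w} [Field K]

/-- The additive Karoubi envelope of `T0 δ`: idempotents in the additive envelope. -/
abbrev T (δ : DegreeFunction A K) := Karoubi (Mat_ (T0 δ))

/-- The inclusion of `T0 δ` in its additive Karoubi envelope. -/
abbrev T0.incl (δ : DegreeFunction A K) : T0 δ ⥤ T δ := Mat_.embedding (T0 δ) ⋙ toKaroubi (Mat_ (T0 δ))


end T

section Functors

variable {A : Type u} [Category.{v} A] {A' : Type u₁} [Category.{v₁} A']
variable {K : Type w} [Field K]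

/-- `F` preserves epimorphisms and their degrees. -/
def PreservesDegree (F : A ⥤ A') (δ : DegreeFunction A K) (δ' : DegreeFunction A' K) : Prop :=
  ∀ ⦃x y : A⦄ (e : x ⟶ y) (he : Epi e), ∃ h : Epi (F.map e), δ'.deg (F.map e) h = δ.deg e he

variable [FCRegular A] [FCRegular A']

lemma mono_prodComparison (F : A ⥤ A') [PreservesLimitsOfShape WalkingCospan F] (x y : A) :
    Mono (prodComparison F x y) := by
  have h := (IsPullback.of_hasBinaryProduct' x y).map F
  constructor
  intro w f g hfg
  apply h.hom_ext
  · simpa only [Category.assoc, prodComparison_fst] using congr($hfg ≫ prod.fst)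
  · simpa only [Category.assoc, prodComparison_snd] using congr($hfg ≫ prod.snd)

/-- `F(r) ⊂ F(x × y)` viewed as a subobject of `F(x) × F(y)`. -/
def mapRel (F : A ⥤ A') [PreservesLimitsOfShape WalkingCospan F] {x y : A}
    (r : Subobject (x ⨯ y)) : Subobject (F.obj x ⨯ F.obj y) :=
  have := mono_prodComparison F x y
  have := preserves_mono_of_preservesLimit F r.arrow
  Subobject.mk (F.map r.arrow ≫ prodComparison F x y)

/-- The assignment `[x] ↦ [F x]`, `⟨r⟩ ↦ ⟨F(r)⟩`, extended linearly; at this point merely a map of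
objects and morphisms. -/
def mapT0 (F : A ⥤ A') [PreservesLimitsOfShape WalkingCospan F] (δ : DegreeFunction A K)
    (δ' : DegreeFunction A' K) : T0 δ ⥤q T0 δ' where
  obj X := ⟨F.obj X.of⟩
  map f := Finsupp.lmapDomain K K (mapRel F) f

end Functors

/-- A map of objects and morphisms which respects identities and composition. -/
structure IsFunctorial {C : Type u} [Category.{v} C] {D : Type u₁} [Category.{v₁} D]
    (P : C ⥤q D) : Prop where
  map_id : ∀ X : C, P.map (𝟙 X) = 𝟙 (P.obj X)
  map_comp : ∀ {X Y Z : C} (f : X ⟶ Y) (g : Y ⟶ Z), P.map (f ≫ g) = P.map f ≫ P.map g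

/-- The functor given by a map of objects and morphisms respecting identities and composition. -/
def IsFunctorial.functor {C : Type u} [Category.{v} C] {D : Type u₁} [Category.{v₁} D]
    {P : C ⥤q D} (h : IsFunctorial P) : C ⥤ D where
  obj := P.obj
  map f := P.map f
  map_id := h.map_id
  map_comp := h.map_comp

section Sets

lemma hasImages_of_fac (A : Type u) [Category.{v} A] [HasPullbacks A] [Balanced A]
    (H : ∀ {x y : A} (f : x ⟶ y), ∃ (i : A) (e : x ⟶ i) (m : i ⟶ y), Epi e ∧ Mono m ∧ e ≫ m = f) :
    HasImages A := by
  refine ⟨fun {x y} f => ?_⟩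
  obtain ⟨i, e, m, he, hm, hf⟩ := H f
  have key : ∀ G : MonoFactorisation f, IsIso (pullback.fst m G.m) := by
    intro G
    have h : pullback.lift e G.e (by rw [hf, G.fac]) ≫ pullback.fst m G.m = e :=
      pullback.lift_fst _ _ _
    have : Epi (pullback.fst m G.m) := epi_of_epi_fac h
    exact isIso_of_mono_of_epi _
  exact HasImage.mk
    { F := { I := i, m := m, e := e, fac := hf }
      isImage :=
        { lift := fun G => have := key G; inv (pullback.fst m G.m) ≫ pullback.snd m G.m
          lift_fac := fun G => by
            have := key G
            change (inv (pullback.fst m G.m) ≫ pullback.snd m G.m) ≫ G.m = m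
            rw [Category.assoc, IsIso.inv_comp_eq, pullback.condition] } }

lemma FintypeCat.mono_iff {X Y : FintypeCat.{u}} (f : X ⟶ Y) :
    Mono f ↔ Function.Injective f :=
  ConcreteCategory.mono_iff_injective_of_preservesPullback f

lemma FintypeCat.epi_iff {X Y : FintypeCat.{u}} (f : X ⟶ Y) :
    Epi f ↔ Function.Surjective f :=
  ConcreteCategory.epi_iff_surjective_of_preservesPushout f

instance : Balanced FintypeCat.{u} where
  isIso_of_mono_of_epi f h h' :=
    (FintypeCat.equivEquivIso (Equiv.ofBijective f
      ⟨(FintypeCat.mono_iff f).1 h, (FintypeCat.epi_iff f).1 h'⟩)).isIso_hom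

open scoped Classical in
lemma FintypeCat.pushout {Z X Y P : FintypeCat.{u}} {f : Z ⟶ Y} {g : Z ⟶ X} {i : Y ⟶ P} {j : X ⟶ P}
    (h : IsPushout f g i j) (hf : Function.Injective f) :
    Function.Injective j ∧ Nat.card ↥(Set.range j)ᶜ = Nat.card ↥(Set.range f)ᶜ := by
  let Q : FintypeCat.{u} := FintypeCat.of (X ⊕ ↥(Set.range f)ᶜ)
  let a : Y ⟶ Q := FintypeCat.homMk fun y =>
    if hy : ∃ z, f z = y then Sum.inl (g hy.choose) else Sum.inr ⟨y, hy⟩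
  let b : X ⟶ Q := FintypeCat.homMk Sum.inl
  have ha1 : ∀ z, a (f z) = Sum.inl (g z) := by
    intro z
    have hy : ∃ z', f z' = f z := ⟨z, rfl⟩
    change (if hy : ∃ z', f z' = f z then Sum.inl (g hy.choose) else (Sum.inr ⟨f z, hy⟩ : X ⊕ ↥(Set.range f)ᶜ)) = _
    rw [dif_pos hy, hf hy.choose_spec]
  have ha2 : ∀ y : ↥(Set.range f)ᶜ, a y.1 = Sum.inr y := by
    intro y
    change (if hy : ∃ z', f z' = y then Sum.inl (g hy.choose) else (Sum.inr ⟨y, hy⟩ : X ⊕ ↥(Set.range f)ᶜ)) = _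
    exact dif_neg y.2
  have hab : f ≫ a = g ≫ b := by
    ext z
    exact ha1 z
  have hd1 : ∀ y, h.desc a b hab (i y) = a y := fun y =>
    congrArg (fun k : Y ⟶ Q => k y) (h.inl_desc a b hab)
  have hd2 : ∀ x, h.desc a b hab (j x) = Sum.inl x := fun x =>
    congrArg (fun k : X ⟶ Q => k x) (h.inr_desc a b hab)
  refine ⟨fun x x' hx => ?_, ?_⟩
  · have := congrArg (h.desc a b hab) hx
    rw [hd2, hd2] at this
    exact Sum.inl_injective this
  · symm
    refine Nat.card_congr (Equiv.ofBijective (fun y => ⟨i y.1, ?_⟩) ⟨?_, ?_⟩)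
    · rintro ⟨x, hx⟩
      have := congrArg (h.desc a b hab) hx
      rw [hd2, hd1, ha2] at this
      cases this
    · intro y y' hy
      have := congrArg (h.desc a b hab) (congrArg Subtype.val hy)
      rw [hd1, hd1, ha2, ha2] at this
      exact Sum.inr_injective this
    · rintro ⟨p, hp⟩
      obtain ⟨k, y, hy⟩ := FintypeCat.jointly_surjective _ _ h.isColimit p
      have hinr : ∀ x, j x ≠ p := fun x hx => hp ⟨x, hx⟩
      have hinl : ∃ y, i y = p := by
        match k, y, hy with
        | none, y, hy =>
          refine ⟨f y, ?_⟩
          rw [← hy, ← h.cocone.w WalkingSpan.Hom.fst]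
          rfl
        | some .left, y, hy => exact ⟨y, hy⟩
        | some .right, y, hy => exact (hinr y hy).elim
      obtain ⟨y, hy⟩ := hinl
      refine ⟨⟨y, ?_⟩, Subtype.ext hy⟩
      rintro ⟨z, rfl⟩
      apply hinr (g z)
      rw [← hy]
      exact (congrArg (fun k : Z ⟶ P => k z) h.w).symm

lemma FintypeCat.exists_fac {X Y : FintypeCat.{u}} (f : X ⟶ Y) :
    ∃ (I : FintypeCat.{u}) (e : X ⟶ I) (m : I ⟶ Y), Epi e ∧ Mono m ∧ e ≫ m = f := by
  refine ⟨FintypeCat.of (Set.range f), FintypeCat.homMk (Set.rangeFactorization f),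
    FintypeCat.homMk Subtype.val, ?_, ?_, ?_⟩
  · exact (FintypeCat.epi_iff _).2 Set.rangeFactorization_surjective
  · exact (FintypeCat.mono_iff _).2 Subtype.val_injective
  · ext x; rfl

instance : HasImages FintypeCat.{u}ᵒᵖ :=
  hasImages_of_fac _ fun f => by
    obtain ⟨I, e, m, he, hm, h⟩ := FintypeCat.exists_fac f.unop
    exact ⟨Opposite.op I, m.op, e.op, inferInstance, inferInstance, by rw [← op_comp, h]; rfl⟩

lemma FintypeCat.injective_unop {X Y : FintypeCat.{u}ᵒᵖ} (e : X ⟶ Y) (h : Epi e) :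
    Function.Injective e.unop :=
  (FintypeCat.mono_iff _).1 inferInstance

instance : FCRegular FintypeCat.{u}ᵒᵖ where
  epi_of_isPullback {p x y z e' f' f e} h he := by
    have := (FintypeCat.mono_iff e'.unop).2
      (FintypeCat.pushout h.unop (FintypeCat.injective_unop e he)).1
    exact inferInstanceAs (Epi e'.unop.op)

/-- The degree function `e ↦ t ^ |Y ∖ e(X)|` on the opposite of the category of finite sets, for
injective maps `e : X ⟶ Y` of sets. -/
def setsDegree {K : Type w} [Field K] (t : K) : DegreeFunction FintypeCat.{u}ᵒᵖ K where
  deg e _ := t ^ Nat.card ↥(Set.range e.unop)ᶜ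
  deg_id x := by
    have : IsEmpty ↥(Set.range (𝟙 x : x ⟶ x).unop)ᶜ := ⟨fun y => y.2 ⟨y.1, rfl⟩⟩
    rw [Nat.card_of_isEmpty, pow_zero]
  deg_comp {x y z} e e' h h' := by
    have h1 := FintypeCat.injective_unop e h
    have h2 := FintypeCat.injective_unop e' h'
    have h3 : Function.Injective (e ≫ e').unop := FintypeCat.injective_unop _ (epi_comp e e')
    have key : ∀ {X Y : FintypeCat.{u}} (f : X ⟶ Y), Function.Injective f →
        Nat.card ↥(Set.range f)ᶜ + Nat.card X = Nat.card Y := by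
      intro X Y f hf
      have e1 := Set.ncard_add_ncard_compl (Set.range f)
      rw [Set.ncard_range_of_injective hf] at e1
      rw [add_comm]
      exact e1
    rw [← pow_add]
    congr 1
    have := key _ h1
    have := key _ h2
    have := key _ h3
    omega
  deg_pullback h he _ :=
    congrArg (fun n => t ^ n) (FintypeCat.pushout h.unop (FintypeCat.injective_unop _ he)).2

end Sets

section Vect

variable (F : Type u) [Field F]

instance : FCRegular (FGModuleCat.{u} F) where
  epi_of_isPullback h he := by
    have := h.isoPullback_hom_fst
    rw [← this]
    infer_instance

variable {F}

lemma FGModuleCat.surjective_of_epi {X Y : FGModuleCat.{u} F} (e : X ⟶ Y) (h : Epi e) :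
    Function.Surjective e.hom.hom :=
  (ModuleCat.epi_iff_surjective _).1 (inferInstanceAs (Epi ((forget₂ (FGModuleCat.{u} F) (ModuleCat.{u} F)).map e)))

lemma FGModuleCat.finrank_ker {X Y : FGModuleCat.{u} F} (e : X ⟶ Y) (h : Epi e) :
    Module.finrank F Y + Module.finrank F (LinearMap.ker e.hom.hom) = Module.finrank F X := by
  have := LinearMap.finrank_range_add_finrank_ker e.hom.hom
  rwa [LinearMap.range_eq_top.2 (FGModuleCat.surjective_of_epi e h), finrank_top] at this

lemma FGModuleCat.finrank_ker_pullback {P X Y Z : FGModuleCat.{u} F} {e' : P ⟶ X} {f' : P ⟶ Y}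
    {f : X ⟶ Z} {e : Y ⟶ Z} (h : IsPullback e' f' f e) :
    Module.finrank F (LinearMap.ker e'.hom.hom) = Module.finrank F (LinearMap.ker e.hom.hom) := by
  let N : FGModuleCat.{u} F := FGModuleCat.of F (LinearMap.ker e.hom.hom)
  let i : N ⟶ Y := FGModuleCat.ofHom (LinearMap.ker e.hom.hom).subtype
  let N' : FGModuleCat.{u} F := FGModuleCat.of F (LinearMap.ker e'.hom.hom)
  let i' : N' ⟶ P := FGModuleCat.ofHom (LinearMap.ker e'.hom.hom).subtype
  have hi : (0 : N ⟶ X) ≫ f = i ≫ e := by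
    rw [zero_comp]
    ext x
    exact (LinearMap.mem_ker.1 x.2).symm
  have hi' : i' ≫ e' = 0 := by
    ext x
    exact LinearMap.mem_ker.1 x.2
  let k : N ⟶ P := h.lift 0 i hi
  have hk1 : ∀ x, e'.hom.hom (k.hom.hom x) = 0 := fun x =>
    congrArg (fun g : N ⟶ X => g.hom.hom x) (h.lift_fst 0 i hi)
  have hk2 : ∀ x, f'.hom.hom (k.hom.hom x) = i.hom.hom x := fun x =>
    congrArg (fun g : N ⟶ Y => g.hom.hom x) (h.lift_snd 0 i hi)
  have hw : ∀ p, f.hom.hom (e'.hom.hom p) = e.hom.hom (f'.hom.hom p) := fun p =>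
    congrArg (fun g : P ⟶ Z => g.hom.hom p) h.w
  let g : N' ⟶ N := FGModuleCat.ofHom (LinearMap.codRestrict _ (i' ≫ f').hom.hom fun x =>
    LinearMap.mem_ker.2 (by
      have h0 : e'.hom.hom (i'.hom.hom x) = 0 := congrArg (fun g : N' ⟶ X => g.hom.hom x) hi'
      have := hw (i'.hom.hom x)
      rw [h0, map_zero] at this
      exact this.symm))
  have hg : g ≫ k = i' := by
    apply h.hom_ext
    · rw [Category.assoc, h.lift_fst, comp_zero, hi']
    · rw [Category.assoc, h.lift_snd]
      rfl
  refine le_antisymm (LinearMap.finrank_le_finrank_of_injective (f := g.hom.hom) ?_)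
    (LinearMap.finrank_le_finrank_of_injective
      (f := LinearMap.codRestrict (LinearMap.ker e'.hom.hom) k.hom.hom
        fun x => LinearMap.mem_ker.2 (hk1 x)) ?_)
  · intro x y hxy
    have hg' : ∀ x, k.hom.hom (g.hom.hom x) = i'.hom.hom x := fun x =>
      congrArg (fun g : N' ⟶ P => g.hom.hom x) hg
    apply Subtype.ext
    change i'.hom.hom x = i'.hom.hom y
    rw [← hg', ← hg', hxy]
  · intro x y hxy
    have h1 : k.hom.hom x = k.hom.hom y := congrArg Subtype.val hxy
    apply Subtype.ext
    change i.hom.hom x = i.hom.hom y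
    rw [← hk2, ← hk2, h1]

/-- The degree function `e ↦ t ^ dim (ker e)` on finite-dimensional vector spaces. -/
def vectDegree (F : Type u) [Field F] {K : Type w} [Field K] (t : K) :
    DegreeFunction (FGModuleCat.{u} F) K where
  deg e _ := t ^ Module.finrank F (LinearMap.ker e.hom.hom)
  deg_id x := by
    have : LinearMap.ker (𝟙 x : x ⟶ x).hom.hom = ⊥ := LinearMap.ker_id
    rw [this, finrank_bot, pow_zero]
  deg_comp {x y z} e e' h h' := by
    rw [← pow_add]
    congr 1
    have := FGModuleCat.finrank_ker e h
    have := FGModuleCat.finrank_ker e' h'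
    have := FGModuleCat.finrank_ker (e ≫ e') (epi_comp e e')
    omega
  deg_pullback h _ _ := by rw [FGModuleCat.finrank_ker_pullback h]

/-- The functor sending a finite set to the space of `F`-valued functions on it, and a map of sets
to the pull-back of functions. -/
def funFunctor (F : Type u) [Field F] : FintypeCat.{u}ᵒᵖ ⥤ FGModuleCat.{u} F where
  obj X := FGModuleCat.of F (X.unop → F)
  map f := FGModuleCat.ofHom (LinearMap.funLeft F F f.unop)

/-- The category `Rep(S_t)`. -/
abbrev RepS {K : Type w} [Field K] (t : K) := T (setsDegree.{w, u} t)
/-- The category `Rep(GL_t(F))`. -/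
abbrev RepGL (F : Type u) [Field F] {K : Type w} [Field K] (t : K) := T (vectDegree F t)

end Vect

end Knop

end

/-!
In a regular category `A` the class of a span `x ⟵ w ⟶ y` is `δ(e)⟨r⟩`, where `e` is the
epimorphism from `w` onto the image `r` of `w ⟶ x × y`, and spans are composed by pullback. Hence
a functor `F : A ⥤ A'` which preserves pullbacks, epimorphisms and the degrees of epimorphisms
carries the class of the span `(a, b)` to the class of `(F a, F b)` (`mapDomain_mapRel_span`). As
the classes of spans generate all morphisms, every identity between morphisms has only to be
checked on spans. There compatibility with composition is preservation of pullbacks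
(`mapDomain_mapRel_comp`), and the naturality of the tensor constraints is that of the comparison
morphisms `F(x × y) ⟶ F(x) × F(y)` (`mapDomain_mapRel_tensor`). The remaining coherence conditions
only involve graphs of morphisms, so they are images under `Γ` of identities in `A'` between
comparison morphisms. If `F` preserves the terminal object as well, the constraints are
invertible, and `[x] ↦ [F x]` is strong symmetric monoidal (`braidedMapT0`).

For the functor of functions on finite sets, preservation of finite limits is seen on underlying
sets, where it is representability by the field (`preservesFiniteLimits_funFunctor`). An injection
`X ⟶ Y` induces a surjection on functions, whose kernel has dimension `|Y| - |X|`
(`preservesDegree_funFunctor`).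

Finally any additive symmetric monoidal functor extends to additive Karoubi envelopes: entrywise to
matrices, where the constraints are diagonal matrices (`mapMatMonoidal`, `mapMatBraided`), and then
to idempotents, where the constraints are composed with the idempotents (`mapKarMonoidal`,
`mapKarBraided`). Both extensions restrict to the functor they started from, by isomorphisms with
identity components (`embeddingMapMatIso`, `toKaroubiMapKarIso`); these give `inclMapKarIso`.
-/

noncomputable section

namespace Knop

/-! ### Relations under a functor preserving pullbacks and degrees -/

section Relations

variable {A : Type u} [Category.{v} A] {A' : Type u₁} [Category.{v₁} A']
variable {K : Type w} [Field K] [FCRegular A] [FCRegular A']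
variable {F : A ⥤ A'} [PreservesLimitsOfShape WalkingCospan F]
variable {δ : DegreeFunction A K} {δ' : DegreeFunction A' K}

/-- `F` carries the class of the span `(a, b)` to that of `(F a, F b)`: applied to the epi-mono
factorisation of `w ⟶ x × y`, it gives one of `F w ⟶ F x × F y` with an epimorphism of the same
degree. -/
lemma mapDomain_mapRel_span (hF : PreservesDegree F δ δ') {w x y : A} (a : w ⟶ x) (b : w ⟶ y) :
    Finsupp.mapDomain (mapRel F) (span δ a b) = span δ' (F.map a) (F.map b) := by
  have := mono_prodComparison F x y
  obtain ⟨he, hd⟩ := hF (factorThruImageSubobject (prod.lift a b)) inferInstance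
  have := preserves_mono_of_preservesLimit F (imageSubobject (prod.lift a b)).arrow
  rw [span, Finsupp.mapDomain_single,
    span_eq δ' _ _ (F.map (factorThruImageSubobject (prod.lift a b)))
      (F.map (imageSubobject (prod.lift a b)).arrow ≫ prodComparison F x y) he ?_, hd]
  · rfl
  · rw [← Category.assoc, ← F.map_comp, imageSubobject_arrow_comp]
    apply prod.hom_ext
    · rw [Category.assoc, prodComparison_fst, ← F.map_comp, prod.lift_fst, prod.lift_fst]
    · rw [Category.assoc, prodComparison_snd, ← F.map_comp, prod.lift_snd, prod.lift_snd]

lemma mapDomain_mapRel_rel_graph (hF : PreservesDegree F δ δ') {x y : A} (f : x ⟶ y) :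
    Finsupp.mapDomain (mapRel F) (rel (K := K) (graph f)) = rel (graph (F.map f)) := by
  rw [rel_graph δ, mapDomain_mapRel_span hF, rel_graph δ', F.map_id]

/-- Compatibility with composition: the composite of two spans is given by their pullback, which
`F` preserves. -/
lemma mapDomain_mapRel_comp (hF : PreservesDegree F δ δ') {x y z : A}
    (f : Subobject (x ⨯ y) →₀ K) (g : Subobject (y ⨯ z) →₀ K) :
    Finsupp.lmapDomain K K (mapRel F) (comp δ f g) =
      comp δ' (Finsupp.lmapDomain K K (mapRel F) f) (Finsupp.lmapDomain K K (mapRel F) g) := by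
  induction f using span_induction δ with
  | h0 => simp only [map_zero, LinearMap.zero_apply]
  | hadd f f' hf hf' => simp only [map_add, LinearMap.add_apply, hf, hf']
  | hs k w a b =>
  induction g using span_induction δ with
  | h0 => simp only [map_zero]
  | hadd f f' hf hf' => simp only [map_add, hf, hf']
  | hs k' w' c d =>
  have h : IsPullback _ _ b c := IsPullback.of_hasPullback _ _
  simp only [map_smul, LinearMap.smul_apply, Finsupp.lmapDomain_apply, mapDomain_mapRel_span hF]
  rw [comp_span δ _ _ _ _ _ _ h, comp_span δ' _ _ _ _ _ _ (h.map F), mapDomain_mapRel_span hF,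
    F.map_comp, F.map_comp]

lemma isFunctorial_mapT0 (hF : PreservesDegree F δ δ') : IsFunctorial (mapT0 F δ δ') where
  map_id X := (mapDomain_mapRel_rel_graph hF (𝟙 X.of)).trans
    (congrArg (fun f => rel (graph f)) (F.map_id X.of))
  map_comp f g := mapDomain_mapRel_comp hF f g

/-- Naturality of the comparison `F(x × x') ⟶ F(x) × F(x')` on relations. It is checked on spans,
where it amounts to naturality of the comparison morphism in `A'`. -/
lemma mapDomain_mapRel_tensor (hF : PreservesDegree F δ δ')
    [∀ x y, IsIso (prodComparison F x y)] {x y x' y' : A}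
    (f : Subobject (x ⨯ y) →₀ K) (g : Subobject (x' ⨯ y') →₀ K) :
    comp δ' (Finsupp.lmapDomain K K (mapRel F) (tensor f g))
        (rel (graph (prodComparison F y y'))) =
      comp δ' (rel (graph (prodComparison F x x')))
        (tensor (Finsupp.lmapDomain K K (mapRel F) f) (Finsupp.lmapDomain K K (mapRel F) g)) := by
  induction f using span_induction δ with
  | h0 => simp only [map_zero, LinearMap.zero_apply]
  | hadd f f' hf hf' => simp only [map_add, LinearMap.add_apply, hf, hf']
  | hs k w a b =>
  induction g using span_induction δ with
  | h0 => simp only [map_zero, LinearMap.zero_apply]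
  | hadd f f' hf hf' => simp only [map_add, LinearMap.add_apply, hf, hf']
  | hs k' w' c d =>
  simp only [map_smul, LinearMap.smul_apply, Finsupp.lmapDomain_apply, mapDomain_mapRel_span hF,
    tensor_span]
  congr 2
  rw [comp_span_graph]
  refine Eq.trans ?_ (comp_graph_span δ' (asIso (prodComparison F x x')) _ _).symm
  refine span_iso δ' _ _ _ _ (prodComparison F w w') ?_ ?_
  · rw [← Category.assoc, Iso.comp_inv_eq]
    exact (prodComparison_natural F a c).symm
  · exact (prodComparison_natural F b d).symm

lemma prodComparison_associator (F : A ⥤ A') (x y z : A) :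
    prodComparison F (x ⨯ y) z ≫ prod.map (prodComparison F x y) (𝟙 _) ≫
        (prod.associator (F.obj x) (F.obj y) (F.obj z)).hom =
      F.map (prod.associator x y z).hom ≫ prodComparison F x (y ⨯ z) ≫
        prod.map (𝟙 _) (prodComparison F y z) := by
  ext <;> simp [← Functor.map_comp, prod.lift_fst, prod.lift_snd, prod.lift_snd_assoc]

lemma prodComparison_leftUnitor (F : A ⥤ A') (x : A) :
    (prod.leftUnitor (F.obj x)).inv = F.map (prod.leftUnitor x).inv ≫
      prodComparison F (⊤_ A) x ≫ prod.map (terminal.from _) (𝟙 _) := by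
  ext; simp [← Functor.map_comp, prod.lift_snd]

lemma prodComparison_rightUnitor (F : A ⥤ A') (x : A) :
    (prod.rightUnitor (F.obj x)).inv = F.map (prod.rightUnitor x).inv ≫
      prodComparison F x (⊤_ A) ≫ prod.map (𝟙 _) (terminal.from _) := by
  ext; simp [← Functor.map_comp, prod.lift_fst]

lemma prodComparison_braiding (F : A ⥤ A') (x y : A) :
    F.map (prod.braiding x y).hom ≫ prodComparison F y x =
      prodComparison F x y ≫ (prod.braiding (F.obj x) (F.obj y)).hom := by
  ext <;> simp [← Functor.map_comp, prod.lift_fst, prod.lift_snd]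

end Relations

/-! ### The symmetric monoidal functor `[x] ↦ [F x]` -/

section FunctorT0

variable {A : Type u} [Category.{v} A] {A' : Type u₁} [Category.{v₁} A']
variable {K : Type w} [Field K] [FCRegular A] [FCRegular A']
variable {F : A ⥤ A'} [PreservesLimitsOfShape WalkingCospan F]
variable {δ : DegreeFunction A K} {δ' : DegreeFunction A' K}
variable (h : IsFunctorial (mapT0 F δ δ'))

instance additive_functor_mapT0 : h.functor.Additive where
  map_add {_ _ f g} := map_add (Finsupp.lmapDomain K K (mapRel F)) f g

instance linear_functor_mapT0 : h.functor.Linear K where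
  map_smul f c := map_smul (Finsupp.lmapDomain K K (mapRel F)) c f

lemma functor_map_Γ (hF : PreservesDegree F δ δ') {x y : A} (f : x ⟶ y) :
    h.functor.map ((T0.Γ δ).map f) = (T0.Γ δ').map (F.map f) :=
  mapDomain_mapRel_rel_graph hF f

lemma functor_map_tensorHom (hF : PreservesDegree F δ δ')
    [∀ x y, IsIso (prodComparison F x y)] {X Y X' Y' : T0 δ} (f : X ⟶ Y) (g : X' ⟶ Y') :
    h.functor.map (f ⊗ₘ g) ≫ (T0.Γ δ').map (prodComparison F Y.of Y'.of) =
      (T0.Γ δ').map (prodComparison F X.of X'.of) ≫ (h.functor.map f ⊗ₘ h.functor.map g) :=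
  mapDomain_mapRel_tensor hF f g

/-- The oplax structure on `[x] ↦ [F x]` whose structure morphisms are the graphs of
`F(1) ⟶ 1` and of `F(x × y) ⟶ F(x) × F(y)`; its coherence is that of the comparison morphisms. -/
abbrev oplaxMapT0 (hF : PreservesDegree F δ δ') [∀ x y, IsIso (prodComparison F x y)] :
    h.functor.OplaxMonoidal where
  η := (T0.Γ δ').map (terminal.from (F.obj (⊤_ A)))
  δ X Y := (T0.Γ δ').map (prodComparison F X.of Y.of)
  δ_natural_left {X Y} f X' := by
    have := functor_map_tensorHom h hF f (𝟙 X')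
    rw [h.functor.map_id] at this
    exact this.symm
  δ_natural_right {X Y} X' f := by
    have := functor_map_tensorHom h hF (𝟙 X') f
    rw [h.functor.map_id] at this
    exact this.symm
  oplax_associativity X Y Z := by
    have := congr((T0.Γ δ').map $(prodComparison_associator F X.of Y.of Z.of))
    simp only [Functor.map_comp, ← T0.tensorHom_Γ, ← functor_map_Γ h hF] at this
    exact this
  oplax_left_unitality X := by
    have := congr((T0.Γ δ').map $(prodComparison_leftUnitor F X.of))
    simp only [Functor.map_comp, ← T0.tensorHom_Γ, ← functor_map_Γ h hF] at this
    exact this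
  oplax_right_unitality X := by
    have := congr((T0.Γ δ').map $(prodComparison_rightUnitor F X.of))
    simp only [Functor.map_comp, ← T0.tensorHom_Γ, ← functor_map_Γ h hF] at this
    exact this

/-- The strong monoidal structure on `[x] ↦ [F x]` when `F` preserves finite products. -/
abbrev monoidalMapT0 (hF : PreservesDegree F δ δ') [∀ x y, IsIso (prodComparison F x y)]
    [IsIso (terminal.from (F.obj (⊤_ A)))] : h.functor.Monoidal :=
  letI := oplaxMapT0 h hF
  haveI : IsIso (Functor.OplaxMonoidal.η h.functor) :=
    inferInstanceAs (IsIso ((T0.Γ δ').map (terminal.from (F.obj (⊤_ A)))))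
  haveI (X Y : T0 δ) : IsIso (Functor.OplaxMonoidal.δ h.functor X Y) :=
    inferInstanceAs (IsIso ((T0.Γ δ').map (prodComparison F X.of Y.of)))
  Functor.Monoidal.ofOplaxMonoidal h.functor

lemma monoidalMapT0_δ (hF : PreservesDegree F δ δ') [∀ x y, IsIso (prodComparison F x y)]
    [IsIso (terminal.from (F.obj (⊤_ A)))] (X Y : T0 δ) :
    letI := monoidalMapT0 h hF
    Functor.OplaxMonoidal.δ h.functor X Y = (T0.Γ δ').map (prodComparison F X.of Y.of) :=
  rfl

/-- The strong monoidal structure on `[x] ↦ [F x]` respects the symmetries. -/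
abbrev braidedMapT0 (hF : PreservesDegree F δ δ') [∀ x y, IsIso (prodComparison F x y)]
    [IsIso (terminal.from (F.obj (⊤_ A)))] : h.functor.Braided :=
  letI := monoidalMapT0 h hF
  { braided X Y := by
      rw [← cancel_epi (Functor.OplaxMonoidal.δ h.functor X Y),
        ← cancel_mono (Functor.OplaxMonoidal.δ h.functor Y X)]
      simp only [Category.assoc, Functor.Monoidal.μ_δ, Functor.Monoidal.δ_μ_assoc, Category.comp_id]
      rw [monoidalMapT0_δ, monoidalMapT0_δ]
      have := congr((T0.Γ δ').map $(prodComparison_braiding F X.of Y.of))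
      simp only [Functor.map_comp, ← functor_map_Γ h hF] at this
      exact this }

end FunctorT0

/-! ### Functions on finite sets -/

section FunctionSpaces

variable (F : Type u) [Field F]

/-- Forgetting the vector space structure, `X ↦ F^X` is the functor `Hom(-, F)` on finite sets,
which turns colimits into limits; and limits in `FGModuleCat F` are detected on underlying sets. -/
lemma preservesFiniteLimits_funFunctor : PreservesFiniteLimits (funFunctor F) := by
  let U : FGModuleCat.{u} F ⥤ Type u := forget₂ (FGModuleCat.{u} F) (ModuleCat.{u} F) ⋙ forget _
  let e : funFunctor F ⋙ U ≅ FintypeCat.incl.op ⋙ yoneda.obj F :=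
    NatIso.ofComponents (fun X => Equiv.toIso
      { toFun := fun f => TypeCat.ofHom f
        invFun := fun f => (ConcreteCategory.hom f).1
        left_inv := fun _ => rfl
        right_inv := fun _ => rfl })
      (fun f => by ext; rfl)
  have : PreservesFiniteLimits FintypeCat.incl.{u}.op := preservesFiniteLimits_op _
  have : PreservesFiniteLimits (yoneda.obj F) := PreservesLimits.preservesFiniteLimits _
  have : PreservesFiniteLimits (FintypeCat.incl.op ⋙ yoneda.obj F) :=
    comp_preservesFiniteLimits _ _
  have : PreservesFiniteLimits (funFunctor F ⋙ U) := preservesFiniteLimits_of_natIso e.symm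
  have : ReflectsFiniteLimits U := inferInstance
  exact preservesFiniteLimits_of_reflects_of_preserves _ U

lemma preservesDegree_funFunctor {K : Type w} [Field K] (t : K) :
    PreservesDegree (funFunctor F) (setsDegree t) (vectDegree F t) := by
  intro X Y e he
  have hinj := FintypeCat.injective_unop e he
  have hepi : Epi ((funFunctor F).map e) := by
    apply ConcreteCategory.epi_of_surjective
    exact LinearMap.funLeft_surjective_of_injective F F _ hinj
  refine ⟨hepi, ?_⟩
  have finrank_fun : ∀ Z : FintypeCat.{u}, Module.finrank F (Z → F) = Nat.card Z := fun Z => by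
    have := Fintype.ofFinite Z
    rw [Module.finrank_fintype_fun_eq_card, Nat.card_eq_fintype_card]
  -- Rank-nullity for `F^X ⟶ F^Y` is compared with `|Y| + |X ∖ Y| = |X|`.
  have h1 := FGModuleCat.finrank_ker _ hepi
  have h2 : Module.finrank F ((funFunctor F).obj X) = Nat.card X.unop := finrank_fun X.unop
  have h3 : Module.finrank F ((funFunctor F).obj Y) = Nat.card Y.unop := finrank_fun Y.unop
  have h4 := Set.ncard_add_ncard_compl (Set.range e.unop)
  rw [Set.ncard_range_of_injective hinj] at h4
  change Nat.card Y.unop + _ = Nat.card X.unop at h4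
  change t ^ _ = t ^ (Set.range e.unop)ᶜ.ncard
  congr 1
  omega

end FunctionSpaces

/-! ### Extension of monoidal functors to finite families -/

section MatExtension

variable {C : Type u} [Category.{v} C] [Preadditive C]
variable {D : Type u₁} [Category.{v} D] [Preadditive D]
variable (F : C ⥤ D) [F.Additive]

/-- The value of `F.mapMat_` on a family, in a form which unfolds to a family of objects at
reducible transparency. -/
abbrev mapMatObj (M : Mat_ C) : Mat_ D := ⟨M.ι, fun i => F.obj (M.X i)⟩

/-- The value of `F.mapMat_` on a matrix, as a morphism between `mapMatObj`s. -/
def mapMatMap {M N : Mat_ C} (f : M ⟶ N) : mapMatObj F M ⟶ mapMatObj F N :=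
  F.mapMat_.map f

lemma ent_mapMatMap {M N : Mat_ C} (f : M ⟶ N) (i : M.ι) (j : N.ι) :
    ent (mapMatMap F f) i j = F.map (ent f i j) := rfl

lemma mapMatMap_id (M : Mat_ C) : mapMatMap F (𝟙 M) = 𝟙 (mapMatObj F M) :=
  F.mapMat_.map_id M

lemma mapMatMap_monomial {M N : Mat_ C} (e : M.ι → N.ι) (φ : ∀ i, M.X i ⟶ N.X (e i)) :
    mapMatMap F (monomial e φ) = monomial (M := mapMatObj F M) (N := mapMatObj F N) e
      (fun i => F.map (φ i)) := by
  apply eq_monomial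
  · intro i
    rw [ent_mapMatMap, monomial_self]
  · intro i j h
    rw [ent_mapMatMap, monomial_ne _ _ h, F.map_zero]

instance : F.mapMat_.Additive where
  map_add {_ _ _ _} := mat_ext fun _ _ => F.map_add

variable [MonoidalCategory C] [MonoidalCategory D] [F.Monoidal]

open Functor.LaxMonoidal Functor.OplaxMonoidal

/-- The tensorator of the extension of `F` to finite families, with diagonal entries that of
`F`. -/
def mapMatMu (M N : Mat_ C) :
    matTensor (mapMatObj F M) (mapMatObj F N) ≅ mapMatObj F (matTensor M N) where
  hom := monomial (M := matTensor (mapMatObj F M) (mapMatObj F N))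
    (N := mapMatObj F (matTensor M N)) (fun p => p) (fun p => μ F (M.X p.1) (N.X p.2))
  inv := monomial (N := matTensor (mapMatObj F M) (mapMatObj F N))
    (M := mapMatObj F (matTensor M N)) (fun p => p)
    (fun p => Functor.OplaxMonoidal.δ F (M.X p.1) (N.X p.2))
  hom_inv_id := by
    rw [monomial_comp, id_eq_monomial]
    exact monomial_congr fun i => Functor.Monoidal.μ_δ F _ _
  inv_hom_id := by
    rw [monomial_comp, id_eq_monomial]
    exact monomial_congr fun i => Functor.Monoidal.δ_μ F _ _

/-- The unit constraint of the extension of `F` to finite families. -/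
def mapMatEps : (matUnit : Mat_ D) ≅ mapMatObj F matUnit where
  hom := monomial (M := matUnit) (N := mapMatObj F matUnit) (fun i => i) (fun _ => ε F)
  inv := monomial (N := matUnit) (M := mapMatObj F matUnit) (fun i => i) (fun _ => η F)
  hom_inv_id := by
    rw [monomial_comp, id_eq_monomial]
    exact monomial_congr fun i => Functor.Monoidal.ε_η F
  inv_hom_id := by
    rw [monomial_comp, id_eq_monomial]
    exact monomial_congr fun i => Functor.Monoidal.η_ε F

lemma mapMatMu_natural {M N M' N' : Mat_ C} (f : M ⟶ N) (g : M' ⟶ N') :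
    matTensorHom (mapMatMap F f) (mapMatMap F g) ≫ (mapMatMu F N N').hom =
      (mapMatMu F M M').hom ≫ mapMatMap F (matTensorHom f g) := by
  apply mat_ext
  intro p q
  refine (comp_monomial_ent (M := matTensor (mapMatObj F N) (mapMatObj F N'))
    (N := mapMatObj F (matTensor N N')) _ (fun p => p) (fun _ _ h => h) _ _ _).trans
    (Eq.trans ?_ (monomial_comp_ent (M := matTensor (mapMatObj F M) (mapMatObj F M'))
    (N := mapMatObj F (matTensor M M')) _ _ _ _ _).symm)
  exact μ_natural F _ _

variable [MonoidalPreadditive C] [MonoidalPreadditive D]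

/-- The monoidal structure on the extension of `F` to finite families. All matrices in the coherence
conditions are monomial, so these reduce entrywise to the ones for `F`. -/
instance mapMatMonoidal : F.mapMat_.Monoidal :=
  Functor.CoreMonoidal.toMonoidal
    { εIso := mapMatEps F
      μIso := mapMatMu F
      μIso_hom_natural_left {M N} f P := by
        have := mapMatMu_natural F f (𝟙 P)
        rw [mapMatMap_id] at this
        exact this
      μIso_hom_natural_right {M N} P f := by
        have := mapMatMu_natural F (𝟙 P) f
        rw [mapMatMap_id] at this
        exact this
      associativity X Y Z := by
        change matTensorHom (mapMatMu F X Y).hom (𝟙 (mapMatObj F Z)) ≫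
            (mapMatMu F (matTensor X Y) Z).hom ≫ mapMatMap F (matAssoc X Y Z).hom =
          (matAssoc (mapMatObj F X) (mapMatObj F Y) (mapMatObj F Z)).hom ≫
            matTensorHom (𝟙 (mapMatObj F X)) (mapMatMu F Y Z).hom ≫
              (mapMatMu F X (matTensor Y Z)).hom
        simp only [mapMatMu, matAssoc, mapMatMap_monomial, id_eq_monomial, matTensor_monomial]
        rw [monomial_comp, monomial_comp, monomial_comp, monomial_comp]
        refine monomial_congr fun i => ?_
        simp only [tensorHom_id, id_tensorHom]
        exact Functor.LaxMonoidal.associativity F _ _ _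
      left_unitality X := by
        change (matLeftUnitor (mapMatObj F X)).hom =
          matTensorHom (mapMatEps F).hom (𝟙 (mapMatObj F X)) ≫ (mapMatMu F matUnit X).hom ≫
            mapMatMap F (matLeftUnitor X).hom
        simp only [mapMatMu, mapMatEps, matLeftUnitor, mapMatMap_monomial, id_eq_monomial,
          matTensor_monomial]
        rw [monomial_comp, monomial_comp]
        refine monomial_congr fun i => ?_
        simp only [tensorHom_id]
        exact Functor.LaxMonoidal.left_unitality F _
      right_unitality X := by
        change (matRightUnitor (mapMatObj F X)).hom =
          matTensorHom (𝟙 (mapMatObj F X)) (mapMatEps F).hom ≫ (mapMatMu F X matUnit).hom ≫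
            mapMatMap F (matRightUnitor X).hom
        simp only [mapMatMu, mapMatEps, matRightUnitor, mapMatMap_monomial, id_eq_monomial,
          matTensor_monomial]
        rw [monomial_comp, monomial_comp]
        refine monomial_congr fun i => ?_
        simp only [id_tensorHom]
        exact Functor.LaxMonoidal.right_unitality F _ }

/-- The extension of `F` to finite families restricts to `F` on one-term families. -/
def embeddingMapMatIso : Mat_.embedding C ⋙ F.mapMat_ ≅ F ⋙ Mat_.embedding D :=
  NatIso.ofComponents (fun X => Iso.refl (single (F.obj X))) (fun {X Y} f => by
    change mapMatMap F (embMap f) ≫ 𝟙 (single (F.obj Y)) =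
      𝟙 (single (F.obj X)) ≫ embMap (F.map f)
    rw [Category.comp_id, Category.id_comp]
    rfl)

instance : NatTrans.IsMonoidal (embeddingMapMatIso F).hom where
  unit := by
    change ((mapMatEps F).hom ≫ mapMatMap F (𝟙 matUnit)) ≫ 𝟙 (single (F.obj (𝟙_ C))) =
      𝟙 matUnit ≫ embMap (ε F)
    rw [mapMatMap_id, Category.comp_id, Category.comp_id, Category.id_comp, embMap_eq]
    rfl
  tensor X Y := by
    change ((mapMatMu F (single X) (single Y)).hom ≫ mapMatMap F (embMu X Y).hom) ≫
        𝟙 (single (F.obj (X ⊗ Y))) =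
      matTensorHom (𝟙 (single (F.obj X))) (𝟙 (single (F.obj Y))) ≫
        (embMu (F.obj X) (F.obj Y)).hom ≫ embMap (μ F X Y)
    rw [Category.comp_id]
    simp only [mapMatMu, embMu, mapMatMap_monomial, embMap_eq, id_eq_monomial, matTensor_monomial]
    rw [monomial_comp, monomial_comp, monomial_comp]
    exact monomial_congr fun i => by simp

end MatExtension

section MatLinear

variable {C : Type u} [Category.{v} C] [Preadditive C] [MonoidalCategory C] [MonoidalPreadditive C]
variable {D : Type u₁} [Category.{v} D] [Preadditive D] [MonoidalCategory D] [MonoidalPreadditive D]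

instance {K : Type w} [Field K] [Linear K C] [Linear K D] (F : C ⥤ D) [F.Additive] [F.Linear K] :
    F.mapMat_.Linear K where
  map_smul _ _ := mat_ext fun _ _ => F.map_smul _ _

end MatLinear

section MatSymmetric

variable {C : Type u} [Category.{v} C] [Preadditive C] [MonoidalCategory C]
  [MonoidalPreadditive C] [SymmetricCategory C]
variable {D : Type u₁} [Category.{v} D] [Preadditive D] [MonoidalCategory D]
  [MonoidalPreadditive D] [SymmetricCategory D]

instance mapMatBraided (F : C ⥤ D) [F.Additive] [F.Braided] : F.mapMat_.Braided where
  braided X Y := by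
    change (mapMatMu F X Y).hom ≫ mapMatMap F (matBraiding X Y).hom =
      (matBraiding (mapMatObj F X) (mapMatObj F Y)).hom ≫ (mapMatMu F Y X).hom
    simp only [mapMatMu, matBraiding, mapMatMap_monomial]
    rw [monomial_comp, monomial_comp]
    exact monomial_congr fun i => Functor.LaxBraided.braided _ _

end MatSymmetric

/-! ### Extension of monoidal functors to idempotents -/

section KaroubiExtension

variable {C : Type u} [Category.{v} C] {D : Type u₁} [Category.{v₁} D] (F : C ⥤ D)

/-- The extension of a functor to idempotents. -/
abbrev mapKar : Karoubi C ⥤ Karoubi D := (functorExtension₂ C D).obj F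

instance [Preadditive C] [Preadditive D] [F.Additive] : (mapKar F).Additive where
  map_add {_ _ _ _} := by ext; exact F.map_add

variable [MonoidalCategory C] [MonoidalCategory D]

instance {K : Type w} [Field K] [Preadditive C] [Preadditive D] [Linear K C] [Linear K D]
    [F.Additive] [F.Linear K] : (mapKar F).Linear K where
  map_smul _ _ := by ext; exact F.map_smul _ _

variable [F.Monoidal]

open Functor.LaxMonoidal Functor.OplaxMonoidal

/-- The tensorator of the extension of `F` to idempotents: that of `F`, cut down by the
idempotents. -/
def mapKarMu (P Q : Karoubi C) :
    (mapKar F).obj P ⊗ (mapKar F).obj Q ≅ (mapKar F).obj (P ⊗ Q) where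
  hom := ⟨(F.map P.p ⊗ₘ F.map Q.p) ≫ μ F P.X Q.X, by
    change (F.map P.p ⊗ₘ F.map Q.p) ≫ ((F.map P.p ⊗ₘ F.map Q.p) ≫ μ F P.X Q.X) ≫
      F.map (P.p ⊗ₘ Q.p) = _
    simp only [Category.assoc, μ_natural, μ_natural_assoc, ← F.map_comp, tensorHom_comp_tensorHom,
      Karoubi.idem]
    exact (μ_natural F _ _).symm⟩
  inv := ⟨Functor.OplaxMonoidal.δ F P.X Q.X ≫ (F.map P.p ⊗ₘ F.map Q.p), by
    change F.map (P.p ⊗ₘ Q.p) ≫ (Functor.OplaxMonoidal.δ F P.X Q.X ≫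
      (F.map P.p ⊗ₘ F.map Q.p)) ≫ (F.map P.p ⊗ₘ F.map Q.p) = _
    simp only [Category.assoc, δ_natural, ← F.map_comp_assoc, tensorHom_comp_tensorHom,
      Karoubi.idem]
    exact (δ_natural F _ _).symm⟩
  hom_inv_id := by
    ext
    change ((F.map P.p ⊗ₘ F.map Q.p) ≫ μ F P.X Q.X) ≫ (Functor.OplaxMonoidal.δ F P.X Q.X ≫
      (F.map P.p ⊗ₘ F.map Q.p)) = F.map P.p ⊗ₘ F.map Q.p
    simp only [Category.assoc, Functor.Monoidal.μ_δ_assoc, tensorHom_comp_tensorHom, ← F.map_comp,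
      Karoubi.idem]
  inv_hom_id := by
    ext
    change (Functor.OplaxMonoidal.δ F P.X Q.X ≫ (F.map P.p ⊗ₘ F.map Q.p)) ≫
      ((F.map P.p ⊗ₘ F.map Q.p) ≫ μ F P.X Q.X) = F.map (P.p ⊗ₘ Q.p)
    simp only [Category.assoc, μ_natural, Functor.Monoidal.δ_μ_assoc, μ_natural_assoc,
      ← F.map_comp, tensorHom_comp_tensorHom, Karoubi.idem]

/-- The unit constraint of the extension of `F` to idempotents. -/
def mapKarEps : 𝟙_ (Karoubi D) ≅ (mapKar F).obj (𝟙_ (Karoubi C)) where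
  hom := ⟨ε F, by
    change 𝟙 _ ≫ ε F ≫ F.map (𝟙 _) = _
    simp⟩
  inv := ⟨η F, by
    change F.map (𝟙 _) ≫ η F ≫ 𝟙 _ = _
    simp⟩
  hom_inv_id := by ext; exact Functor.Monoidal.ε_η F
  inv_hom_id := by
    ext
    exact (Functor.Monoidal.η_ε F).trans (F.map_id _).symm

/-- The monoidal structure on the extension of `F` to idempotents. In each coherence condition
naturality moves the idempotents to one side, where they merge and leave the condition for `F`. -/
instance mapKarMonoidal : (mapKar F).Monoidal :=
  Functor.CoreMonoidal.toMonoidal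
    { εIso := mapKarEps F
      μIso := mapKarMu F
      μIso_hom_natural_left {P Q} f R := by
        ext
        change (F.map f.f ⊗ₘ F.map R.p) ≫ (F.map Q.p ⊗ₘ F.map R.p) ≫ μ F _ _ =
          ((F.map P.p ⊗ₘ F.map R.p) ≫ μ F _ _) ≫ F.map (f.f ⊗ₘ R.p)
        simp [tensorHom_comp_tensorHom_assoc, ← F.map_comp, ← μ_natural]
      μIso_hom_natural_right {P Q} R f := by
        ext
        change (F.map R.p ⊗ₘ F.map f.f) ≫ (F.map R.p ⊗ₘ F.map Q.p) ≫ μ F _ _ =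
          ((F.map R.p ⊗ₘ F.map P.p) ≫ μ F _ _) ≫ F.map (R.p ⊗ₘ f.f)
        simp [tensorHom_comp_tensorHom_assoc, ← F.map_comp, ← μ_natural]
      associativity X Y Z := by
        ext
        change (((F.map X.p ⊗ₘ F.map Y.p) ≫ μ F _ _) ⊗ₘ F.map Z.p) ≫
            ((F.map (X.p ⊗ₘ Y.p) ⊗ₘ F.map Z.p) ≫ μ F _ _) ≫
              F.map (((X.p ⊗ₘ Y.p) ⊗ₘ Z.p) ≫ (α_ _ _ _).hom) =
          (((F.map X.p ⊗ₘ F.map Y.p) ⊗ₘ F.map Z.p) ≫ (α_ _ _ _).hom) ≫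
            (F.map X.p ⊗ₘ ((F.map Y.p ⊗ₘ F.map Z.p) ≫ μ F _ _)) ≫
              (F.map X.p ⊗ₘ F.map (Y.p ⊗ₘ Z.p)) ≫ μ F _ _
        have h1 : (((F.map X.p ⊗ₘ F.map Y.p) ≫ μ F _ _) ⊗ₘ F.map Z.p) =
            μ F X.X Y.X ▷ F.obj Z.X ≫ (F.map (X.p ⊗ₘ Y.p) ⊗ₘ F.map Z.p) := by
          rw [μ_natural, ← tensorHom_id, tensorHom_comp_tensorHom, Category.id_comp]
        have h2 : (F.map X.p ⊗ₘ ((F.map Y.p ⊗ₘ F.map Z.p) ≫ μ F _ _)) =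
            F.obj X.X ◁ μ F Y.X Z.X ≫ (F.map X.p ⊗ₘ F.map (Y.p ⊗ₘ Z.p)) := by
          rw [μ_natural, ← id_tensorHom, tensorHom_comp_tensorHom, Category.id_comp]
        have h3 : (F.map X.p ⊗ₘ (F.map Y.p ⊗ₘ F.map Z.p)) ≫ F.obj X.X ◁ μ F Y.X Z.X =
            F.obj X.X ◁ μ F Y.X Z.X ≫ (F.map X.p ⊗ₘ F.map (Y.p ⊗ₘ Z.p)) := by
          rw [← h2, ← id_tensorHom, tensorHom_comp_tensorHom, Category.comp_id]
        rw [h1, h2]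
        simp only [Category.assoc, associator_naturality_assoc, reassoc_of% h3, μ_natural,
          μ_natural_assoc, ← F.map_comp, associator_naturality, tensorHom_comp_tensorHom,
          Karoubi.idem]
        rw [F.map_comp]
        exact Functor.LaxMonoidal.associativity_assoc F _ _ _ _
      left_unitality X := by
        ext
        change (𝟙 _ ⊗ₘ F.map X.p) ≫ (λ_ _).hom = (ε F ⊗ₘ F.map X.p) ≫
          ((F.map (𝟙 _) ⊗ₘ F.map X.p) ≫ μ F _ _) ≫ F.map ((𝟙 _ ⊗ₘ X.p) ≫ (λ_ _).hom)
        have h : (ε F ⊗ₘ F.map X.p) = ε F ▷ F.obj X.X ≫ (F.map (𝟙 _) ⊗ₘ F.map X.p) := by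
          rw [F.map_id, ← tensorHom_id, tensorHom_comp_tensorHom, Category.comp_id,
            Category.id_comp]
        rw [h]
        simp only [Category.assoc, μ_natural_assoc, ← F.map_comp, tensorHom_comp_tensorHom_assoc,
          Karoubi.idem, Category.comp_id]
        rw [id_tensorHom, id_tensorHom, leftUnitor_naturality, leftUnitor_naturality, F.map_comp,
          Functor.LaxMonoidal.left_unitality]
        simp only [Category.assoc]
      right_unitality X := by
        ext
        change (F.map X.p ⊗ₘ 𝟙 _) ≫ (ρ_ _).hom = (F.map X.p ⊗ₘ ε F) ≫
          ((F.map X.p ⊗ₘ F.map (𝟙 _)) ≫ μ F _ _) ≫ F.map ((X.p ⊗ₘ 𝟙 _) ≫ (ρ_ _).hom)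
        have h : (F.map X.p ⊗ₘ ε F) = F.obj X.X ◁ ε F ≫ (F.map X.p ⊗ₘ F.map (𝟙 _)) := by
          rw [F.map_id, ← id_tensorHom, tensorHom_comp_tensorHom, Category.comp_id,
            Category.id_comp]
        rw [h]
        simp only [Category.assoc, μ_natural_assoc, ← F.map_comp, tensorHom_comp_tensorHom_assoc,
          Karoubi.idem, Category.comp_id]
        rw [tensorHom_id, tensorHom_id, rightUnitor_naturality, rightUnitor_naturality, F.map_comp,
          Functor.LaxMonoidal.right_unitality]
        simp only [Category.assoc] }

/-- The extension of `F` to idempotents restricts to `F` on identities. -/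
def toKaroubiMapKarIso : toKaroubi C ⋙ mapKar F ≅ F ⋙ toKaroubi D :=
  NatIso.ofComponents (fun X =>
      { hom := ⟨𝟙 (F.obj X), by
          change F.map (𝟙 X) ≫ 𝟙 _ ≫ 𝟙 _ = _
          simp⟩
        inv := ⟨𝟙 (F.obj X), by
          change 𝟙 _ ≫ 𝟙 _ ≫ F.map (𝟙 X) = _
          simp⟩
        hom_inv_id := by ext; exact (Category.comp_id _).trans (F.map_id X).symm
        inv_hom_id := by ext; exact Category.comp_id _ })
    (fun {X Y} f => by ext; exact (Category.comp_id _).trans (Category.id_comp _).symm)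

instance : NatTrans.IsMonoidal (toKaroubiMapKarIso F).hom where
  unit := by
    ext
    change (ε F ≫ F.map (𝟙 _)) ≫ 𝟙 _ = 𝟙 _ ≫ ε F
    simp
  tensor X Y := by
    ext
    change (((F.map (𝟙 _) ⊗ₘ F.map (𝟙 _)) ≫ μ F _ _) ≫ F.map (𝟙 _)) ≫ 𝟙 _ =
      (𝟙 _ ⊗ₘ 𝟙 _) ≫ 𝟙 _ ≫ μ F _ _
    simp

end KaroubiExtension

instance mapKarBraided {C : Type u} [Category.{v} C] [MonoidalCategory C] [SymmetricCategory C]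
    {D : Type u₁} [Category.{v₁} D] [MonoidalCategory D] [SymmetricCategory D]
    (F : C ⥤ D) [F.Braided] : (mapKar F).Braided where
  braided X Y := by
    ext
    change ((F.map X.p ⊗ₘ F.map Y.p) ≫ Functor.LaxMonoidal.μ F _ _) ≫
        F.map ((X.p ⊗ₘ Y.p) ≫ (β_ _ _).hom) =
      ((F.map X.p ⊗ₘ F.map Y.p) ≫ (β_ _ _).hom) ≫ (F.map Y.p ⊗ₘ F.map X.p) ≫
        Functor.LaxMonoidal.μ F _ _
    simp only [Category.assoc, BraidedCategory.braiding_naturality_assoc, ← F.map_comp,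
      BraidedCategory.braiding_naturality, Functor.LaxMonoidal.μ_natural,
      Functor.LaxMonoidal.μ_natural_assoc]
    rw [← Functor.LaxBraided.braided_assoc]
    simp only [← F.map_comp]

/-! ### Extension to additive Karoubi envelopes -/

section Envelope

variable {C : Type u} [Category.{v} C] [Preadditive C] [MonoidalCategory C] [MonoidalPreadditive C]
variable {D : Type u₁} [Category.{v} D] [Preadditive D] [MonoidalCategory D] [MonoidalPreadditive D]

/-- The extension of `F` to additive Karoubi envelopes restricts to `F`. -/
def inclMapKarIso (F : C ⥤ D) [F.Additive] :
    (Mat_.embedding C ⋙ toKaroubi (Mat_ C)) ⋙ mapKar F.mapMat_ ≅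
      F ⋙ Mat_.embedding D ⋙ toKaroubi (Mat_ D) :=
  (Functor.associator _ _ _ ≪≫
    Functor.isoWhiskerLeft (Mat_.embedding C) (toKaroubiMapKarIso F.mapMat_)) ≪≫
  ((Functor.associator _ _ _).symm ≪≫
    Functor.isoWhiskerRight (embeddingMapMatIso F) (toKaroubi (Mat_ D))) ≪≫
  Functor.associator _ _ _

instance (F : C ⥤ D) [F.Additive] [F.Monoidal] : NatTrans.IsMonoidal (inclMapKarIso F).hom := by
  unfold inclMapKarIso
  simp only [Iso.trans_hom, Iso.symm_hom, Functor.isoWhiskerLeft_hom, Functor.isoWhiskerRight_hom]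
  infer_instance

end Envelope

end Knop

end

theorem mainTheorem7 {𝕂 : Type w} [Field 𝕂] {F : Type u} [Field F] [Finite F] (t : 𝕂) :
    Knop.PreservesDegree (Knop.funFunctor F) (Knop.setsDegree t) (Knop.vectDegree F t) ∧
    PreservesLimitsOfShape (Discrete PEmpty.{1}) (Knop.funFunctor F) ∧
    ∃ (_ : PreservesLimitsOfShape WalkingCospan (Knop.funFunctor F))
      (h : Knop.IsFunctorial
        (Knop.mapT0 (Knop.funFunctor F) (Knop.setsDegree t) (Knop.vectDegree F t)))
      (_ : h.functor.Additive) (_ : h.functor.Linear 𝕂) (_ : h.functor.Braided),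
      Functor.OplaxMonoidal.η h.functor = (Knop.T0.Γ (Knop.vectDegree F t)).map
        (terminal.from ((Knop.funFunctor F).obj (⊤_ FintypeCat.{u}ᵒᵖ))) ∧
      (∀ X Y : FintypeCat.{u}ᵒᵖ, Functor.OplaxMonoidal.δ h.functor ⟨X⟩ ⟨Y⟩ =
        (Knop.T0.Γ (Knop.vectDegree F t)).map (prodComparison (Knop.funFunctor F) X Y)) ∧
      ∃ (G : Knop.RepS.{w, u} t ⥤ Knop.RepGL F t)
        (_ : G.Additive) (_ : G.Linear 𝕂) (_ : G.Braided)
        (e : Knop.T0.incl (Knop.setsDegree t) ⋙ G ≅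
          h.functor ⋙ Knop.T0.incl (Knop.vectDegree F t)),
        NatTrans.IsMonoidal e.hom := by
  have := Knop.preservesFiniteLimits_funFunctor F
  have hF := Knop.preservesDegree_funFunctor F t
  have : IsIso (terminal.from ((Knop.funFunctor F).obj (⊤_ FintypeCat.{u}ᵒᵖ))) :=
    inferInstanceAs (IsIso (terminalComparison (Knop.funFunctor F)))
  let h := Knop.isFunctorial_mapT0 hF
  let _ : h.functor.Braided := Knop.braidedMapT0 h hF
  exact ⟨hF, inferInstance, inferInstance, h, inferInstance, inferInstance, inferInstance, rfl,
    fun _ _ => rfl, Knop.mapKar h.functor.mapMat_, inferInstance, inferInstance, inferInstance,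
    Knop.inclMapKarIso h.functor, inferInstance⟩
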